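/- **Lemma (Non-resonant estimates).** Work on $\mathbb{R}^2$ with spinors in $\mathbb{C}^2$, and let $\gamma^0=\begin{pmatrix}1&0\\0&-1\end{pmatrix}$, $\gamma^1=\begin{pmatrix}0&1\\-1&0\end{pmatrix}$, $\gamma^2=\begin{pmatrix}0&-i\\-i&0\end{pmatrix}$, $\alpha^\mu=\gamma^0\gamma^\mu$ $(\mu=0,1,2)$, $\beta=\gamma^0$, $D=-i\nabla$, $\langle x\rangle=(1+|x|^2)^{1/2}$. Let $\langle\cdot,\cdot\rangle$ applied to two spinors be the standard Hermitian inner product on $\mathbb{C}^2$, and $\|u\|_{H^s}=\|\langle D\rangle^s u\|_{L^2}$. For $\theta\in\{+,-\}$ put $$\Pi_\theta(D)=\tfrac12\Big(I+\theta\,\langle D\rangle^{-1}\big[\alpha^1D_1+\alpha^2D_2+\beta\big]\Big),\qquad \psi_\theta=\Pi_\theta(D)\psi .$$ Fix $\rho\in C_0^\infty(B(0,2))$, real-valued, with $\rho(\xi)=1$ for $|\xi|\le1$, and for $N\in2^{\mathbb{Z}}$ let $P_N$ be the Fourier multiplier with symbol $\rho_N(\xi)=\rho(\xi/N)-\rho(2\xi/N)$.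 Fix $s\ge 50$. For $T\geq 0$ and $\psi:[0,T]\to L^2(\mathbb{R}^2;\mathbb{C}^2)$ let $$\|\psi\|_{\Sigma_T}=\sum_{\theta\in\{\pm\}}\ \sup_{t\in[0,T]}\Big(\|\psi_\theta(t)\|_{H^s}+\big\|x\,e^{\theta it\langle D\rangle}\psi_\theta(t)\big\|_{H^5}\Big)\in[0,\infty].$$ Then for every $K>0$ and every $\gamma>0$ there is a constant $C>0$, depending only on $\rho,s,K,\gamma$, such that for all $T\ge0$, all $\varepsilon_1>0$ and all $\psi$ satisfying the a priori assumption $\|\psi\|_{\Sigma_T}\le K\varepsilon_1$, $$\big\|P_N\langle\psi_\theta(t),\alpha^\mu\psi_\theta(t)\rangle\big\|_{L^2(\mathbb{R}^2)}\le C\,N^{-1}\,\langle t\rangle^{-\frac74+\gamma}\,\varepsilon_1^2$$ for all $t\in[0,T]$, $N\in2^{\mathbb{Z}}$, $\mu\in\{0,1,2\}$ and $\theta\in\{+,-\}$. -/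

import Mathlib

open MeasureTheory FourierTransform
open scoped ENNReal ContDiff

noncomputable section

namespace DiracCSP

/-- The physical (and the frequency) plane. -/
abbrev Plane := EuclideanSpace ℝ (Fin 2)

/-- The space of spinors, with its Hermitian inner product. -/
abbrev Spinor := EuclideanSpace ℂ (Fin 2)

/-- Square integrable spinor fields on the plane. -/
abbrev L2Spinor := Lp (α := Plane) Spinor 2 volume

/-- The Japanese bracket `(1 + |x|²)^{1/2}`, for vectors and for real numbers. -/
def bracket {V : Type*} [NormedAddCommGroup V] (x : V) : ℝ := Real.sqrt (1 + ‖x‖ ^ 2)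

/-- The Dirac gamma matrices. -/
def gammaMat : Fin 3 → Matrix (Fin 2) (Fin 2) ℂ :=
  ![!![1, 0; 0, -1], !![0, 1; -1, 0], !![0, -Complex.I; -Complex.I, 0]]

/-- The matrices `α^μ = γ⁰ γ^μ`. -/
def alphaMat (μ : Fin 3) : Matrix (Fin 2) (Fin 2) ℂ := gammaMat 0 * gammaMat μ

/-- `α^μ` acting on spinors. -/
def alphaOp (μ : Fin 3) : Spinor →L[ℂ] Spinor :=
  Matrix.toEuclideanCLM (n := Fin 2) (𝕜 := ℂ) (alphaMat μ)

/-- `β = γ⁰` acting on spinors. -/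
def betaOp : Spinor →L[ℂ] Spinor :=
  Matrix.toEuclideanCLM (n := Fin 2) (𝕜 := ℂ) (gammaMat 0)

/-- The sign `θ ∈ {+, -}` as a real number. -/
def sgn (θ : ℤˣ) : ℝ := ((θ : ℤ) : ℝ)

/-- The symbol of `Π_θ(D) = ½ (I + θ ⟨D⟩⁻¹ (α · D + β))`, where `D = -i∇`. -/
def projSymbol (θ : ℤˣ) (ξ : Plane) : Spinor →L[ℂ] Spinor :=
  (1 / 2 : ℂ) • (ContinuousLinearMap.id ℂ Spinor +
    ((sgn θ * (bracket ξ)⁻¹ : ℝ) : ℂ) •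
      (((ξ 0 : ℝ) : ℂ) • alphaOp 1 + ((ξ 1 : ℝ) : ℂ) • alphaOp 2 + betaOp))

/-- The symbol of the operator `e^{θ i t ⟨D⟩}`. -/
def waveSymbol (θ : ℤˣ) (t : ℝ) (ξ : Plane) : Spinor →L[ℂ] Spinor :=
  Complex.exp (((sgn θ * t * bracket ξ : ℝ) : ℂ) * Complex.I) • ContinuousLinearMap.id ℂ Spinor

lemma continuous_bracket : Continuous (bracket : Plane → ℝ) := by
  unfold bracket
  fun_prop

lemma bracket_pos (ξ : Plane) : 0 < bracket ξ := by
  unfold bracket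
  positivity

lemma abs_coord_le_bracket (ξ : Plane) (j : Fin 2) : |ξ j| ≤ bracket ξ := by
  have h : ‖ξ j‖ ≤ ‖ξ‖ := PiLp.norm_apply_le ξ j
  rw [Real.norm_eq_abs] at h
  refine h.trans (Real.le_sqrt_of_sq_le ?_)
  linarith

lemma one_le_bracket (ξ : Plane) : 1 ≤ bracket ξ := by
  unfold bracket
  refine Real.le_sqrt_of_sq_le ?_
  nlinarith [sq_nonneg ‖ξ‖]

lemma abs_sgn (θ : ℤˣ) : |sgn θ| = 1 := by
  rcases Int.units_eq_one_or θ with h | h <;> simp [sgn, h]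

lemma continuous_projSymbol (θ : ℤˣ) : Continuous (projSymbol θ) := by
  have h : Continuous fun ξ : Plane => (bracket ξ)⁻¹ :=
    continuous_bracket.inv₀ fun ξ => (bracket_pos ξ).ne'
  unfold projSymbol
  fun_prop

lemma bounded_projSymbol (θ : ℤˣ) : ∃ C : ℝ, ∀ ξ, ‖projSymbol θ ξ‖ ≤ C := by
  refine ⟨1 / 2 * (‖ContinuousLinearMap.id ℂ Spinor‖ +
    (‖alphaOp 1‖ + ‖alphaOp 2‖ + ‖betaOp‖)), fun ξ => ?_⟩
  have hb := bracket_pos ξ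
  have h1 := one_le_bracket ξ
  have hn : ‖((sgn θ * (bracket ξ)⁻¹ : ℝ) : ℂ)‖ = (bracket ξ)⁻¹ := by
    rw [Complex.norm_real, Real.norm_eq_abs, abs_mul, abs_sgn, one_mul,
      abs_of_pos (inv_pos.mpr hb)]
  have hc : ∀ j : Fin 2, ‖((ξ j : ℝ) : ℂ)‖ ≤ bracket ξ := fun j => by
    rw [Complex.norm_real, Real.norm_eq_abs]
    exact abs_coord_le_bracket ξ j
  have hsum : ‖((ξ 0 : ℝ) : ℂ) • alphaOp 1 + ((ξ 1 : ℝ) : ℂ) • alphaOp 2 + betaOp‖ ≤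
      bracket ξ * (‖alphaOp 1‖ + ‖alphaOp 2‖ + ‖betaOp‖) := by
    refine (norm_add₃_le).trans ?_
    rw [norm_smul, norm_smul]
    have e1 := mul_le_mul_of_nonneg_right (hc 0) (norm_nonneg (alphaOp 1))
    have e2 := mul_le_mul_of_nonneg_right (hc 1) (norm_nonneg (alphaOp 2))
    have e3 := mul_le_mul_of_nonneg_right h1 (norm_nonneg betaOp)
    linarith
  have hhalf : ‖(1 / 2 : ℂ)‖ = 1 / 2 := by norm_num
  unfold projSymbol
  rw [norm_smul, hhalf]
  refine mul_le_mul_of_nonneg_left ((norm_add_le _ _).trans ?_) (by norm_num)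
  rw [norm_smul, hn]
  have := mul_le_mul_of_nonneg_left hsum (inv_pos.mpr hb).le
  rw [← mul_assoc, inv_mul_cancel₀ hb.ne', one_mul] at this
  linarith

lemma continuous_waveSymbol (θ : ℤˣ) (t : ℝ) : Continuous (waveSymbol θ t) := by
  have h := continuous_bracket
  unfold waveSymbol
  fun_prop

lemma bounded_waveSymbol (θ : ℤˣ) (t : ℝ) : ∃ C : ℝ, ∀ ξ, ‖waveSymbol θ t ξ‖ ≤ C := by
  refine ⟨‖ContinuousLinearMap.id ℂ Spinor‖, fun ξ => ?_⟩
  unfold waveSymbol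
  rw [norm_smul, Complex.norm_exp_ofReal_mul_I, one_mul]

lemma memLp_symbol_apply (m : Plane → Spinor →L[ℂ] Spinor) (hm : Continuous m)
    (hb : ∃ C : ℝ, ∀ ξ, ‖m ξ‖ ≤ C) (u : L2Spinor) :
    MemLp (fun η : Plane => m ((2 * Real.pi) • η) (u η)) 2 volume := by
  obtain ⟨C, hC⟩ := hb
  have hu := Lp.memLp u
  have hm' : Continuous fun η : Plane => m ((2 * Real.pi) • η) := by fun_prop
  refine hu.of_le_mul (c := C) ?_ (Filter.Eventually.of_forall fun η => ?_)
  · exact (isBoundedBilinearMap_apply (𝕜 := ℂ)).continuous.comp_aestronglyMeasurable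
      (hm'.aestronglyMeasurable.prodMk hu.1)
  · exact (ContinuousLinearMap.le_opNorm _ _).trans
      (mul_le_mul_of_nonneg_right (hC _) (norm_nonneg _))

/-- The Fourier multiplier `m(D)` on `L²`, for a bounded continuous matrix-valued symbol `m`.
The Fourier transform of the library uses the character `e^{-2πi x·η}`, so that `D = -i∇`
has the symbol `ξ = 2πη`. -/
def multiplier (m : Plane → Spinor →L[ℂ] Spinor) (hm : Continuous m)
    (hb : ∃ C : ℝ, ∀ ξ, ‖m ξ‖ ≤ C) (u : L2Spinor) : L2Spinor :=
  𝓕⁻ ((memLp_symbol_apply m hm hb (𝓕 u)).toLp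
    (fun η : Plane => m ((2 * Real.pi) • η) ((𝓕 u : L2Spinor) η)))

/-- The projection `ψ_θ = Π_θ(D) ψ`. -/
def proj (θ : ℤˣ) (u : L2Spinor) : L2Spinor :=
  multiplier (projSymbol θ) (continuous_projSymbol θ) (bounded_projSymbol θ) u

/-- The operator `e^{θ i t ⟨D⟩}`. -/
def wave (θ : ℤˣ) (t : ℝ) (u : L2Spinor) : L2Spinor :=
  multiplier (waveSymbol θ t) (continuous_waveSymbol θ t) (bounded_waveSymbol θ t) u

open Classical in
/-- The norm of `H^s`, for `s ≥ 0`, of a function on the plane with values in a Hilbert space: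
the `L²` norm of `⟨D⟩^s u`, computed on the Fourier side. It is `∞` when `u ∉ H^s`. -/
def sobolevNorm {E : Type*} [NormedAddCommGroup E] [InnerProductSpace ℂ E] [CompleteSpace E]
    (s : ℝ) (u : Plane → E) : ℝ≥0∞ :=
  if h : MemLp u 2 volume then
    eLpNorm (fun η : Plane => ((bracket ((2 * Real.pi) • η) ^ s : ℝ) : ℂ) •
      (𝓕 (h.toLp u) : Lp (α := Plane) E 2 volume) η) 2 volume
  else ∞

/-- The field `x f = x ⊗ f`, with the components `x_j f`. -/
def posMul (f : Plane → Spinor) (x : Plane) : PiLp 2 (fun _ : Fin 2 => Spinor) :=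
  WithLp.toLp 2 fun j => ((x j : ℝ) : ℂ) • f x

/-- `‖ψ_θ‖_{Σ_T^θ} = sup_{t ∈ [0,T]} (‖ψ_θ(t)‖_{H^s} + ‖x e^{θ i t ⟨D⟩} ψ_θ(t)‖_{H^5})`. -/
def sigmaNormSign (s T : ℝ) (θ : ℤˣ) (φ : ℝ → L2Spinor) : ℝ≥0∞ :=
  ⨆ t ∈ Set.Icc (0 : ℝ) T, (sobolevNorm s (φ t) + sobolevNorm 5 (posMul (wave θ t (φ t))))

/-- `‖ψ‖_{Σ_T} = ‖ψ_+‖_{Σ_T^+} + ‖ψ_-‖_{Σ_T^-}`. -/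
def sigmaNorm (s T : ℝ) (ψ : ℝ → L2Spinor) : ℝ≥0∞ :=
  sigmaNormSign s T 1 (fun t => proj 1 (ψ t)) + sigmaNormSign s T (-1) (fun t => proj (-1) (ψ t))

/-- A Littlewood–Paley function: `ρ ∈ C_0^∞(B(0,2))` with `ρ = 1` on `|ξ| ≤ 1`. -/
structure IsLittlewoodPaley (ρ : Plane → ℝ) : Prop where
  smooth : ContDiff ℝ ∞ ρ
  support : tsupport ρ ⊆ Metric.ball 0 2
  eq_one : ∀ ξ : Plane, ‖ξ‖ ≤ 1 → ρ ξ = 1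

/-- `ρ_N(ξ) = ρ(ξ/N) - ρ(2ξ/N)`. -/
def dyadicCutoff (ρ : Plane → ℝ) (N : ℝ) (ξ : Plane) : ℝ :=
  ρ (N⁻¹ • ξ) - ρ ((2 / N) • ξ)

/-- The frequency projection `P_N g`, with symbol `ρ_N`, of an integrable function `g`. -/
def lpProj (ρ : Plane → ℝ) (N : ℝ) (g : Plane → ℂ) : Plane → ℂ :=
  𝓕⁻ (fun η : Plane => ((dyadicCutoff ρ N ((2 * Real.pi) • η) : ℝ) : ℂ) * 𝓕 g η)

/-- The density `⟨u, α^μ u⟩`, an integrable function for `u ∈ L²`. -/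
def density (μ : Fin 3) (u : L2Spinor) (x : Plane) : ℂ :=
  inner ℂ (u x) (alphaOp μ (u x))

end DiracCSP

end

noncomputable section

namespace DiracCSP

/-! ### The L² Fourier transform compared with the Fourier integral. -/

section Fourier

set_option linter.unusedSectionVars false

variable {F : Type*} [NormedAddCommGroup F] [InnerProductSpace ℂ F] [CompleteSpace F]

/-! The symbol of `P_N` is the difference of the values of a Lipschitz function at two points at
distance `|ξ|/N`, so `P_N` is bounded by `N⁻¹` times a gradient (`exists_eLpNorm_lpProj_le`). It
remains to show that the gradient of `⟨φ, α^μ φ⟩` is `O(⟨t⟩^(-7/4))` in L² for a half-wave `φ =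
ψ_θ(t)`, whose Fourier transform is `e^{-iτE}` times a profile, with `τ = θt` and `E = ⟨2πη⟩`.

That gradient is a commutator: `∂_k⟨u, Lu⟩ = 2πi(⟨u, L η_k u⟩ - ⟨η_k u, L u⟩)`, where `η_k` acts as
a multiplier. The real function `x_j` passes freely from one entry to the other. On a free wave it
acts as `τ V_j`, with `V = 2πη/E` the group velocity, up to an error controlled by the profile and
its gradient. Hence a commutator with `V_j` is `O(1/τ)` in L², by an L² × L^∞ estimate
(`l2Bound_commDensity_vel`). Algebra carries this to `η_k`: the identity `|V|² = 1 - E⁻²` gives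
commutators with `E²`; the formula `A - B = (A² - B²) ∫₀^∞ e^{-l(A+B)} dl` gives those with `E`
(`commDensity_energy_eq_integral`); and `2πη_k = E V_k`. For frequencies at most `R` the gradient is
therefore at most a constant times `R⁴ ‖u‖_∞ / τ`.

The same estimate yields the pointwise decay. For `L = id` the density is `|u|²`: its integral is
bounded, and its first two derivatives are `O(‖u‖_∞/τ)` in L². Fourier inversion with frequency
threshold `1/τ` gives, up to powers of `R`, `‖u‖_∞² ≲ τ⁻² + τ^(-15/16) ‖u‖_∞`, so `‖u‖_∞ ≲
τ^(-15/16)` (`exists_supBound`). The gradient then decays like `τ^(-31/16)` up to powers of `R`.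
With `R = τ^(1/50)` the higher frequencies are absorbed by fifty derivatives in L², and the losses
still leave `τ^(-7/4)` (`exists_l2Bound_crossDeriv_decay`). Times below 1 need only a uniform bound.
-/

lemma integral_schwartz_smul_fourier (Ψ : SchwartzMap Plane ℂ) (f : Lp (α := Plane) F 2 volume) :
    ∫ η, Ψ η • (𝓕 f : Lp (α := Plane) F 2 volume) η = ∫ x, 𝓕 (Ψ : Plane → ℂ) x • f x := by
  have h := congrArg (fun T : TemperedDistribution Plane F => T Ψ)
    (Lp.fourier_toTemperedDistribution_eq f)
  simp only [TemperedDistribution.fourier_apply, Lp.toTemperedDistribution_apply] at h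
  rw [← h]
  simp only [SchwartzMap.fourier_coe]

/-- The L² transform is determined by duality with Schwartz functions and the Fourier integral by
Fubini. Both have the same pairings with smooth compactly supported functions, hence agree almost
everywhere. -/
lemma fourier_toLp_ae_eq {G : Plane → F} (hG : MemLp G 2 volume) (hi : Integrable G volume) :
    ((𝓕 (hG.toLp G) : Lp (α := Plane) F 2 volume) : Plane → F) =ᵐ[volume] 𝓕 G := by
  have hc : Continuous (𝓕 G) := VectorFourier.fourierIntegral_continuous
    Real.continuous_fourierChar (by exact continuous_inner) hi
  refine ae_eq_of_integral_contDiff_smul_eq ((Lp.memLp _).locallyIntegrable (by norm_num))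
    hc.locallyIntegrable fun g hg hgc => ?_
  have hg' : HasCompactSupport (Complex.ofRealCLM ∘ g) := hgc.comp_left rfl
  have hgd : ContDiff ℝ ∞ (Complex.ofRealCLM ∘ g) := Complex.ofRealCLM.contDiff.comp hg
  have h := integral_schwartz_smul_fourier (hg'.toSchwartzMap hgd) (hG.toLp G)
  have h2 : ∫ ξ, (𝓕 (hg'.toSchwartzMap hgd : Plane → ℂ) ξ) • G ξ =
      ∫ x, (hg'.toSchwartzMap hgd x) • 𝓕 G x :=
    VectorFourier.integral_fourierIntegral_smul_eq_flip (L := innerₗ Plane)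
      Real.continuous_fourierChar continuous_inner (hg'.toSchwartzMap hgd).integrable hi |>.trans
      (by simp only [flip_innerₗ]; rfl)
  have h3 : ∫ x, 𝓕 (hg'.toSchwartzMap hgd : Plane → ℂ) x • (hG.toLp G) x =
      ∫ ξ, (𝓕 (hg'.toSchwartzMap hgd : Plane → ℂ) ξ) • G ξ := by
    refine integral_congr_ae ?_
    filter_upwards [hG.coeFn_toLp] with x hx
    rw [hx]
  rw [h3, h2] at h
  simpa using h

lemma eLpNorm_Lp_fourier (f : Lp (α := Plane) F 2 volume) :
    eLpNorm (𝓕 f : Lp (α := Plane) F 2 volume) 2 volume = eLpNorm f 2 volume := by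
  have h := Lp.norm_fourier_eq f
  rw [Lp.norm_def, Lp.norm_def] at h
  exact (ENNReal.toReal_eq_toReal_iff' (Lp.eLpNorm_ne_top _) (Lp.eLpNorm_ne_top _)).1 h

/-- **Plancherel's theorem** for functions in `L¹ ∩ L²`. -/
lemma eLpNorm_fourier_eq {G : Plane → F} (hG : MemLp G 2 volume) (hi : Integrable G) :
    eLpNorm (𝓕 G) 2 volume = eLpNorm G 2 volume := by
  rw [← eLpNorm_congr_ae (fourier_toLp_ae_eq hG hi), eLpNorm_Lp_fourier,
    eLpNorm_congr_ae hG.coeFn_toLp]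

lemma memLp_comp_neg {G : Plane → F} (hG : MemLp G 2 volume) :
    MemLp (fun x => G (-x)) 2 volume :=
  hG.comp_measurePreserving (Measure.measurePreserving_neg volume)

lemma eLpNorm_fourierInv_eq {G : Plane → F} (hG : MemLp G 2 volume) (hi : Integrable G) :
    eLpNorm (𝓕⁻ G) 2 volume = eLpNorm G 2 volume := by
  rw [Real.fourierInv_eq_fourier_comp_neg, eLpNorm_fourier_eq (memLp_comp_neg hG) hi.comp_neg]
  exact eLpNorm_comp_measurePreserving hG.1 (Measure.measurePreserving_neg volume)

lemma continuous_fourierInv {G : Plane → F} (hi : Integrable G) : Continuous (𝓕⁻ G) := by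
  rw [Real.fourierInv_eq_fourier_comp_neg]
  exact VectorFourier.fourierIntegral_continuous
    Real.continuous_fourierChar (by exact continuous_inner) hi.comp_neg

lemma continuous_fourier {G : Plane → F} (hi : Integrable G) : Continuous (𝓕 G) :=
  VectorFourier.fourierIntegral_continuous
    Real.continuous_fourierChar (by exact continuous_inner) hi

lemma norm_fourierInv_le (G : Plane → F) (x : Plane) : ‖𝓕⁻ G x‖ ≤ ∫ η, ‖G η‖ := by
  rw [Real.fourierInv_eq]
  refine (norm_integral_le_integral_norm _).trans (le_of_eq ?_)
  simp

lemma norm_fourier_le (G : Plane → F) (x : Plane) : ‖𝓕 G x‖ ≤ ∫ η, ‖G η‖ := by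
  rw [Real.fourier_eq]
  refine (norm_integral_le_integral_norm _).trans (le_of_eq ?_)
  simp

/-- An `L²` function whose Fourier transform is integrable is the inverse Fourier integral of its
Fourier transform. -/
lemma ae_eq_fourierInv (f : Lp (α := Plane) F 2 volume)
    (hi : Integrable ((𝓕 f : Lp (α := Plane) F 2 volume) : Plane → F) volume) :
    f =ᵐ[volume] 𝓕⁻ ((𝓕 f : Lp (α := Plane) F 2 volume) : Plane → F) := by
  set v : Lp (α := Plane) F 2 volume := 𝓕 f with hv
  have hm := Lp.memLp v
  have hneg := memLp_comp_neg hm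
  have hcn := hi.comp_neg
  -- the inverse transform on `L²` is the transform of the reflection
  have h1 : ∀ g : Lp (α := Plane) F 2, ∀ Ψ : SchwartzMap Plane ℂ,
      ∫ η, Ψ η • (𝓕⁻ g : Lp (α := Plane) F 2 volume) η = ∫ x, (𝓕⁻ Ψ : SchwartzMap Plane ℂ) x • g x := by
    intro g Ψ
    have h := integral_schwartz_smul_fourier (𝓕⁻ Ψ : SchwartzMap Plane ℂ) (𝓕⁻ g)
    rw [FourierTransform.fourier_fourierInv_eq] at h
    rw [h, ← SchwartzMap.fourier_coe, FourierTransform.fourier_fourierInv_eq]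
  have hf : f = 𝓕⁻ v := (FourierTransform.fourierInv_fourier_eq f).symm
  refine ae_eq_of_integral_contDiff_smul_eq ((Lp.memLp _).locallyIntegrable (by norm_num))
    (continuous_fourierInv hi).locallyIntegrable fun g hg hgc => ?_
  have hg' : HasCompactSupport (Complex.ofRealCLM ∘ g) := hgc.comp_left rfl
  have hgd : ContDiff ℝ ∞ (Complex.ofRealCLM ∘ g) := Complex.ofRealCLM.contDiff.comp hg
  -- Both sides are tested against `g`: by duality on L², and by Fubini for the integral with the
  -- character of opposite sign.
  have h := h1 v (hg'.toSchwartzMap hgd)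
  have h2 : ∫ ξ, (𝓕⁻ (hg'.toSchwartzMap hgd : Plane → ℂ) ξ) • v ξ =
      ∫ x, (hg'.toSchwartzMap hgd x) • 𝓕⁻ (v : Plane → F) x := by
    have := VectorFourier.integral_fourierIntegral_smul_eq_flip (L := -innerₗ Plane)
      Real.continuous_fourierChar (by exact continuous_inner.neg)
      ((hg'.toSchwartzMap hgd).integrable (μ := volume)) hi
    have e : (-innerₗ Plane).flip = -innerₗ Plane := by
      ext x y; simp [real_inner_comm]
    rw [e] at this
    exact this
  rw [SchwartzMap.fourierInv_coe, h2, ← hf] at h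
  simpa using h

end Fourier

/-! ### Coordinates, and derivatives on the Fourier side. -/

/-- The standard basis vectors of the plane. -/
def basisVec (k : Fin 2) : Plane := EuclideanSpace.single k 1

lemma inner_basisVec (k : Fin 2) (x : Plane) : inner ℝ x (basisVec k) = x k := by
  simp [basisVec, EuclideanSpace.inner_single_right]

lemma norm_basisVec (k : Fin 2) : ‖basisVec k‖ = 1 := by
  simp [basisVec]

lemma norm_le_sum_coord (x : Plane) : ‖x‖ ≤ |x 0| + |x 1| := by
  rw [EuclideanSpace.norm_eq, Fin.sum_univ_two]
  refine Real.sqrt_le_iff.2 ⟨by positivity, ?_⟩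
  simp only [Real.norm_eq_abs]
  nlinarith [abs_nonneg (x 0), abs_nonneg (x 1)]

lemma plane_eq_sum (x : Plane) : x = x 0 • basisVec 0 + x 1 • basisVec 1 := by
  ext i
  fin_cases i <;> simp [basisVec]

lemma norm_clm_le_sum_basisVec {E : Type*} [NormedAddCommGroup E] [NormedSpace ℝ E]
    (A : Plane →L[ℝ] E) : ‖A‖ ≤ ‖A (basisVec 0)‖ + ‖A (basisVec 1)‖ := by
  refine A.opNorm_le_bound (by positivity) fun x => ?_
  have h0 : |x 0| ≤ ‖x‖ := PiLp.norm_apply_le x 0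
  have h1 : |x 1| ≤ ‖x‖ := PiLp.norm_apply_le x 1
  calc ‖A x‖ = ‖x 0 • A (basisVec 0) + x 1 • A (basisVec 1)‖ := by
        conv_lhs => rw [plane_eq_sum x]
        rw [map_add, map_smul, map_smul]
    _ ≤ |x 0| * ‖A (basisVec 0)‖ + |x 1| * ‖A (basisVec 1)‖ := by
        refine (norm_add_le _ _).trans ?_
        rw [norm_smul, norm_smul, Real.norm_eq_abs, Real.norm_eq_abs]
    _ ≤ _ := by nlinarith [norm_nonneg (A (basisVec 0)), norm_nonneg (A (basisVec 1))]

/-- The symbol of the derivative `∂_k`, acting on the Fourier side. -/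
def derivSym {F : Type*} [NormedAddCommGroup F] [InnerProductSpace ℂ F] (k : Fin 2)
    (G : Plane → F) (η : Plane) : F := (2 * Real.pi * Complex.I * (η k : ℂ)) • G η

section

set_option linter.unusedSectionVars false

variable {F : Type*} [NormedAddCommGroup F] [InnerProductSpace ℂ F] [CompleteSpace F]

lemma differentiable_fourierInv {G : Plane → F} (hi : Integrable G)
    (hi' : Integrable fun η => ‖η‖ * ‖G η‖) : Differentiable ℝ (𝓕⁻ G) := by
  rw [Real.fourierInv_eq_fourier_comp_neg]
  refine Real.differentiable_fourier hi.comp_neg ?_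
  simpa using hi'.comp_neg

lemma fderiv_fourierInv {G : Plane → F} (hi : Integrable G)
    (hi' : Integrable fun η => ‖η‖ * ‖G η‖) (k : Fin 2) (x : Plane) :
    fderiv ℝ (𝓕⁻ G) x (basisVec k) = 𝓕⁻ (derivSym k G) x := by
  have hn : Integrable fun η : Plane => ‖η‖ * ‖G (-η)‖ := by simpa using hi'.comp_neg
  rw [Real.fourierInv_eq_fourier_comp_neg, Real.fderiv_fourier hi.comp_neg hn,
    Real.fourier_continuousLinearMap_apply, Real.fourierInv_eq_fourier_comp_neg]
  · refine congrArg (fun g : Plane → F => 𝓕 g x) (funext fun η => ?_)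
    simp only [VectorFourier.fourierSMulRight_apply, derivSym]
    rw [innerSL_apply_apply, inner_basisVec, ← Complex.coe_smul (η k), smul_smul]
    congr 1
    simp
  · refine (hn.const_mul (2 * Real.pi * ‖innerSL ℝ (E := Plane)‖)).mono' ?_ ?_
    · exact hi.comp_neg.1.fourierSMulRight
    · refine Filter.Eventually.of_forall fun η => ?_
      refine (VectorFourier.norm_fourierSMulRight_le _ _ _).trans (le_of_eq ?_)
      ring

lemma fourier_partialDeriv {g : Plane → ℂ} (hg : Integrable g) (hd : Differentiable ℝ g)
    (h : ∀ k, Integrable fun x => fderiv ℝ g x (basisVec k)) (k : Fin 2) (ξ : Plane) :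
    𝓕 (fun x => fderiv ℝ g x (basisVec k)) ξ = derivSym k (𝓕 g) ξ := by
  have hm : AEStronglyMeasurable (fderiv ℝ g) volume := by
    exact (measurable_fderiv ℝ g).aestronglyMeasurable
  have hi : Integrable (fderiv ℝ g) := by
    refine ((h 0).norm.add (h 1).norm).mono' hm ?_
    exact Filter.Eventually.of_forall fun x => norm_clm_le_sum_basisVec _
  have := congrArg (fun A => A ξ (basisVec k)) (Real.fourier_fderiv hg hd hi)
  rw [Real.fourier_continuousLinearMap_apply hi] at this
  rw [this]
  simp only [VectorFourier.fourierSMulRight_apply, derivSym, neg_apply]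
  rw [← Complex.coe_smul, smul_smul, innerSL_apply_apply, inner_basisVec]
  congr 1
  push_cast
  ring

end

/-! ### Quantitative L² bounds. -/

lemma eLpNorm_two_eq {X H : Type*} [MeasurableSpace X] {ν : Measure X} [NormedAddCommGroup H]
    (h : X → H) : eLpNorm h 2 ν = (∫⁻ a, ‖h a‖ₑ ^ (2 : ℝ) ∂ν) ^ (1 / 2 : ℝ) := by
  rw [eLpNorm_eq_lintegral_rpow_enorm_toReal (by norm_num) (by norm_num)]
  simp

/-- `f` is square integrable, with norm at most `c`. -/
def L2Bound {F : Type*} [NormedAddCommGroup F] (f : Plane → F) (c : ℝ) : Prop :=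
  AEStronglyMeasurable f volume ∧ eLpNorm f 2 volume ≤ ENNReal.ofReal c

namespace L2Bound

variable {F G : Type*} [NormedAddCommGroup F] [NormedAddCommGroup G] {f g : Plane → F} {c d : ℝ}

lemma memLp (h : L2Bound f c) : MemLp f 2 volume :=
  ⟨h.1, h.2.trans_lt ENNReal.ofReal_lt_top⟩

lemma mono (h : L2Bound f c) (hcd : c ≤ d) : L2Bound f d :=
  ⟨h.1, h.2.trans (ENNReal.ofReal_le_ofReal hcd)⟩

lemma add (hf : L2Bound f c) (hg : L2Bound g d) (hc : 0 ≤ c) (hd : 0 ≤ d) :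
    L2Bound (fun x => f x + g x) (c + d) :=
  ⟨hf.1.add hg.1, by
    rw [ENNReal.ofReal_add hc hd]
    exact (eLpNorm_add_le hf.1 hg.1 (by norm_num)).trans (add_le_add hf.2 hg.2)⟩

lemma neg (hf : L2Bound f c) : L2Bound (fun x => -f x) c :=
  ⟨hf.1.neg, by rw [show (fun x => -f x) = -f from rfl, eLpNorm_neg]; exact hf.2⟩

lemma sub (hf : L2Bound f c) (hg : L2Bound g d) (hc : 0 ≤ c) (hd : 0 ≤ d) :
    L2Bound (fun x => f x - g x) (c + d) := by
  simpa only [sub_eq_add_neg] using hf.add hg.neg hc hd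

lemma of_le_mul {k : Plane → G} {a : ℝ} (hf : L2Bound f c)
    (hk : AEStronglyMeasurable k volume) (ha : 0 ≤ a) (h : ∀ᵐ x, ‖k x‖ ≤ a * ‖f x‖) :
    L2Bound k (a * c) :=
  ⟨hk, by
    rw [ENNReal.ofReal_mul ha]
    exact (eLpNorm_le_mul_eLpNorm_of_ae_le_mul h 2).trans (by gcongr; exact hf.2)⟩

lemma congr_ae (hf : L2Bound f c) (h : f =ᵐ[volume] g) : L2Bound g c :=
  ⟨hf.1.congr h, by rw [← eLpNorm_congr_ae h]; exact hf.2⟩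

lemma const_smul {F : Type*} [NormedAddCommGroup F] [NormedSpace ℂ F] {f : Plane → F} (a : ℂ)
    (hf : L2Bound f c) : L2Bound (fun x => a • f x) (‖a‖ * c) :=
  hf.of_le_mul (hf.1.const_smul a) (norm_nonneg a)
    (Filter.Eventually.of_forall fun x => (norm_smul a (f x)).le)

lemma fourierInv {F : Type*} [NormedAddCommGroup F] [InnerProductSpace ℂ F] [CompleteSpace F]
    {f : Plane → F} (hf : L2Bound f c) (hi : Integrable f) : L2Bound (𝓕⁻ f) c :=
  ⟨(continuous_fourierInv hi).aestronglyMeasurable, by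
    rw [eLpNorm_fourierInv_eq hf.memLp hi]; exact hf.2⟩

/-- The Cauchy–Schwarz inequality. -/
lemma integral_norm_mul_le (hf : L2Bound f c) {g : Plane → G} (hg : L2Bound g d)
    (hc : 0 ≤ c) (hd : 0 ≤ d) :
    Integrable (fun x => ‖f x‖ * ‖g x‖) ∧ ∫ x, ‖f x‖ * ‖g x‖ ≤ c * d := by
  have hm : AEStronglyMeasurable (fun x => ‖f x‖ * ‖g x‖) volume := hf.1.norm.mul hg.1.norm
  have h2 : ∫⁻ x, ‖f x‖ₑ * ‖g x‖ₑ ≤ ENNReal.ofReal c * ENNReal.ofReal d := by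
    refine (ENNReal.lintegral_mul_le_Lp_mul_Lq volume Real.HolderConjugate.two_two
      hf.1.enorm hg.1.enorm).trans ?_
    rw [← eLpNorm_two_eq, ← eLpNorm_two_eq]
    exact mul_le_mul' hf.2 hg.2
  have h3 : ∫⁻ x, ‖‖f x‖ * ‖g x‖‖ₑ ≤ ENNReal.ofReal (c * d) := by
    rw [ENNReal.ofReal_mul hc]
    simpa [enorm_mul] using h2
  refine ⟨⟨hm, h3.trans_lt ENNReal.ofReal_lt_top⟩, ?_⟩
  refine (Real.le_norm_self _).trans ?_
  refine ENNReal.ofReal_le_ofReal_iff (by positivity) |>.1 ?_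
  rw [ofReal_norm]
  exact (enorm_integral_le_lintegral_enorm _).trans h3

end L2Bound

/-! ### Sesquilinear densities and their gradients. -/

/-- The sesquilinear density `⟨F, L G⟩`. -/
def cross (L : Spinor →L[ℂ] Spinor) (F G : Plane → Spinor) (x : Plane) : ℂ :=
  inner ℂ (F x) (L (G x))

lemma norm_cross_le (L : Spinor →L[ℂ] Spinor) (F G : Plane → Spinor) (x : Plane) :
    ‖cross L F G x‖ ≤ ‖L‖ * (‖F x‖ * ‖G x‖) := by
  refine (norm_inner_le_norm _ _).trans ?_
  nlinarith [L.le_opNorm (G x), norm_nonneg (F x)]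

lemma aestronglyMeasurable_cross (L : Spinor →L[ℂ] Spinor) {F G : Plane → Spinor}
    (hF : AEStronglyMeasurable F volume) (hG : AEStronglyMeasurable G volume) :
    AEStronglyMeasurable (cross L F G) volume :=
  hF.inner (L.continuous.comp_aestronglyMeasurable hG)

lemma L2Bound.cross_left {L : Spinor →L[ℂ] Spinor} {F G : Plane → Spinor} {c a : ℝ}
    (hF : L2Bound F c) (hG : AEStronglyMeasurable G volume) (ha : ∀ x, ‖G x‖ ≤ a) :
    L2Bound (cross L F G) (‖L‖ * a * c) := by
  have h0 : 0 ≤ a := (norm_nonneg _).trans (ha 0)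
  refine hF.of_le_mul (aestronglyMeasurable_cross L hF.1 hG) (by positivity)
    (Filter.Eventually.of_forall fun x => (norm_cross_le L F G x).trans ?_)
  have := mul_le_mul_of_nonneg_left (ha x) (norm_nonneg (F x))
  nlinarith [norm_nonneg L]

lemma L2Bound.cross_right {L : Spinor →L[ℂ] Spinor} {F G : Plane → Spinor} {c a : ℝ}
    (hG : L2Bound G c) (hF : AEStronglyMeasurable F volume) (ha : ∀ x, ‖F x‖ ≤ a) :
    L2Bound (cross L F G) (‖L‖ * a * c) := by
  have h0 : 0 ≤ a := (norm_nonneg _).trans (ha 0)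
  refine hG.of_le_mul (aestronglyMeasurable_cross L hF hG.1) (by positivity)
    (Filter.Eventually.of_forall fun x => (norm_cross_le L F G x).trans ?_)
  have := mul_le_mul_of_nonneg_right (ha x) (norm_nonneg (G x))
  nlinarith [norm_nonneg L]

lemma L2Bound.integral_norm_cross_le {L : Spinor →L[ℂ] Spinor} {F G : Plane → Spinor} {c d : ℝ}
    (hF : L2Bound F c) (hG : L2Bound G d) (hc : 0 ≤ c) (hd : 0 ≤ d) :
    Integrable (cross L F G) ∧ ∫ x, ‖cross L F G x‖ ≤ ‖L‖ * (c * d) := by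
  obtain ⟨h1, h2⟩ := hF.integral_norm_mul_le hG hc hd
  have hi : Integrable (cross L F G) := (h1.const_mul ‖L‖).mono'
    (aestronglyMeasurable_cross L hF.1 hG.1)
    (Filter.Eventually.of_forall fun x => norm_cross_le L F G x)
  refine ⟨hi, ?_⟩
  calc ∫ x, ‖cross L F G x‖ ≤ ∫ x, ‖L‖ * (‖F x‖ * ‖G x‖) :=
        integral_mono hi.norm (h1.const_mul _) fun x => norm_cross_le L F G x
    _ = ‖L‖ * ∫ x, ‖F x‖ * ‖G x‖ := integral_const_mul _ _
    _ ≤ _ := by gcongr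

/-- A function in `L¹ ∩ L²`. -/
structure IntSq (G : Plane → Spinor) : Prop where
  int : Integrable G
  sq : MemLp G 2 volume

lemma integrable_norm_mul_of_derivSym {G : Plane → Spinor} (hG : IntSq G)
    (h : ∀ k, IntSq (derivSym k G)) : Integrable fun η => ‖η‖ * ‖G η‖ := by
  refine ((h 0).int.norm.add (h 1).int.norm).mono'
    (continuous_norm.aestronglyMeasurable.mul hG.int.1.norm)
    (Filter.Eventually.of_forall fun η => ?_)
  simp only [Pi.add_apply, derivSym, norm_smul, norm_mul, Complex.norm_I, Complex.norm_real,
    Real.norm_eq_abs, Complex.norm_ofNat, mul_one, abs_norm, abs_of_pos Real.pi_pos]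
  have h1 := norm_le_sum_coord η
  have h2 : |η 0| + |η 1| ≤ 2 * Real.pi * (|η 0| + |η 1|) := by
    nlinarith [Real.pi_gt_three, abs_nonneg (η 0), abs_nonneg (η 1)]
  calc ‖η‖ * ‖G η‖ ≤ (2 * Real.pi * (|η 0| + |η 1|)) * ‖G η‖ := by
        gcongr; exact h1.trans h2
    _ = _ := by ring

lemma IntSq.l2Bound {G : Plane → Spinor} (h : IntSq G) : ∃ c, 0 ≤ c ∧ L2Bound G c :=
  ⟨(eLpNorm G 2 volume).toReal, ENNReal.toReal_nonneg, h.sq.1,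
    (ENNReal.ofReal_toReal h.sq.2.ne).ge⟩

lemma differentiable_cross (L : Spinor →L[ℂ] Spinor) {F G : Plane → Spinor}
    (hF : Differentiable ℝ F) (hG : Differentiable ℝ G) : Differentiable ℝ (cross L F G) := by
  have h : Differentiable ℝ fun x => L (G x) := (L.restrictScalars ℝ).differentiable.comp hG
  exact hF.inner ℂ h

lemma fderiv_cross (L : Spinor →L[ℂ] Spinor) {F G : Plane → Spinor}
    (hF : Differentiable ℝ F) (hG : Differentiable ℝ G) (x v : Plane) :
    fderiv ℝ (cross L F G) x v =
      cross L F (fun x => fderiv ℝ G x v) x + cross L (fun x => fderiv ℝ F x v) G x := by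
  have h : Differentiable ℝ fun x => L (G x) := (L.restrictScalars ℝ).differentiable.comp hG
  have h2 : fderiv ℝ (fun x => L (G x)) x v = L (fderiv ℝ G x v) := by
    have := ((L.restrictScalars ℝ).hasFDerivAt.comp x (hG x).hasFDerivAt).fderiv
    exact congrArg (fun A => A v) this
  refine (fderiv_inner_apply ℂ (hF x) (h x) v).trans ?_
  rw [h2]
  rfl

section

variable (L : Spinor →L[ℂ] Spinor) {G H : Plane → Spinor}

lemma integrable_cross_fourierInv (hG : IntSq G) (hH : IntSq H) :
    Integrable (cross L (𝓕⁻ G) (𝓕⁻ H)) := by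
  obtain ⟨c, hc, hGc⟩ := hG.l2Bound
  obtain ⟨d, hd, hHd⟩ := hH.l2Bound
  exact ((hGc.fourierInv hG.int).integral_norm_cross_le (hHd.fourierInv hH.int) hc hd).1

/-- The derivative `∂_k` of the density of two fields given on the Fourier side. -/
def crossDeriv (k : Fin 2) (G H : Plane → Spinor) (x : Plane) : ℂ :=
  cross L (𝓕⁻ G) (𝓕⁻ (derivSym k H)) x + cross L (𝓕⁻ (derivSym k G)) (𝓕⁻ H) x

variable (hG : IntSq G) (hH : IntSq H) (hG' : ∀ k, IntSq (derivSym k G))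
  (hH' : ∀ k, IntSq (derivSym k H))
include hG hH hG' hH'

lemma differentiable_cross_fourierInv : Differentiable ℝ (cross L (𝓕⁻ G) (𝓕⁻ H)) :=
  differentiable_cross L
    (differentiable_fourierInv hG.int (integrable_norm_mul_of_derivSym hG hG'))
    (differentiable_fourierInv hH.int (integrable_norm_mul_of_derivSym hH hH'))

lemma fderiv_cross_fourierInv (k : Fin 2) (x : Plane) :
    fderiv ℝ (cross L (𝓕⁻ G) (𝓕⁻ H)) x (basisVec k) = crossDeriv L k G H x := by
  have h1 := integrable_norm_mul_of_derivSym hG hG'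
  have h2 := integrable_norm_mul_of_derivSym hH hH'
  rw [fderiv_cross L (differentiable_fourierInv hG.int h1) (differentiable_fourierInv hH.int h2)]
  simp only [fderiv_fourierInv hG.int h1, fderiv_fourierInv hH.int h2]
  rfl

lemma integrable_crossDeriv (k : Fin 2) : Integrable (crossDeriv L k G H) :=
  (integrable_cross_fourierInv L hG (hH' k)).add (integrable_cross_fourierInv L (hG' k) hH)

lemma fourier_crossDeriv (k : Fin 2) :
    𝓕 (crossDeriv L k G H) = derivSym k (𝓕 (cross L (𝓕⁻ G) (𝓕⁻ H))) := by
  funext ξ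
  have e : ∀ k, (fun x => fderiv ℝ (cross L (𝓕⁻ G) (𝓕⁻ H)) x (basisVec k)) =
      crossDeriv L k G H := fun k =>
    funext fun x => fderiv_cross_fourierInv L hG hH hG' hH' k x
  rw [← fourier_partialDeriv (integrable_cross_fourierInv L hG hH)
    (differentiable_cross_fourierInv L hG hH hG' hH') (fun k => ?_) k ξ, e]
  rw [e]
  exact integrable_crossDeriv L hG hH hG' hH' k

/-- Plancherel, in the direction used throughout: gradients of densities are estimated in physical
space, while the frequency projection consumes bounds on the Fourier side. -/
lemma l2Bound_derivSym_fourier_cross {k : Fin 2} {c : ℝ}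
    (h : L2Bound (crossDeriv L k G H) c) :
    L2Bound (derivSym k (𝓕 (cross L (𝓕⁻ G) (𝓕⁻ H)))) c := by
  have hi := integrable_crossDeriv L hG hH hG' hH' k
  rw [← fourier_crossDeriv L hG hH hG' hH']
  exact ⟨(continuous_fourier hi).aestronglyMeasurable, by
    rw [eLpNorm_fourier_eq h.memLp hi]; exact h.2⟩

end

/-! ### The Littlewood–Paley gain and a pointwise bound by Fourier inversion. -/

lemma norm_derivSym {F : Type*} [NormedAddCommGroup F] [InnerProductSpace ℂ F] (k : Fin 2)
    (G : Plane → F) (η : Plane) : ‖derivSym k G η‖ = 2 * Real.pi * |η k| * ‖G η‖ := by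
  simp [derivSym, norm_smul, abs_of_pos Real.pi_pos]

/-- The Littlewood–Paley projection to frequencies of size `N` gains a factor `N⁻¹` over
the derivative. -/
lemma exists_eLpNorm_lpProj_le {ρ : Plane → ℝ} (hρ : IsLittlewoodPaley ρ) :
    ∃ C : ℝ, 0 < C ∧ ∀ (N : ℝ) (g : Plane → ℂ) (c : ℝ), 0 < N → Integrable g → 0 ≤ c →
      (∀ k, L2Bound (derivSym k (𝓕 g)) c) →
      eLpNorm (lpProj ρ N g) 2 volume ≤ ENNReal.ofReal (C * N⁻¹ * c) := by
  have hcs : HasCompactSupport ρ := (isCompact_closedBall (0 : Plane) 2).of_isClosed_subset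
    (isClosed_tsupport ρ) (hρ.support.trans Metric.ball_subset_closedBall)
  obtain ⟨A, hA⟩ := hρ.smooth.lipschitzWith_of_hasCompactSupport hcs (by simp)
  refine ⟨2 * (A + 1), by positivity, fun N g c hN hg hc h => ?_⟩
  -- The arguments `ξ/N` and `2ξ/N` are `|ξ|/N` apart, and `ρ` is Lipschitz with constant `A`. The
  -- constant `A + 1` only ensures positivity.
  have hlip : ∀ ξ, |dyadicCutoff ρ N ξ| ≤ (A + 1) * N⁻¹ * ‖ξ‖ := fun ξ => by
    have := hA.dist_le_mul (N⁻¹ • ξ) ((2 / N) • ξ)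
    rw [Real.dist_eq, dist_eq_norm, ← sub_smul, norm_smul] at this
    have e : N⁻¹ - 2 / N = -N⁻¹ := by field_simp; norm_num
    rw [e, norm_neg, Real.norm_of_nonneg (inv_pos.2 hN).le] at this
    refine this.trans ?_
    have : 0 ≤ N⁻¹ * ‖ξ‖ := by positivity
    nlinarith
  set M : Plane → ℂ := fun η =>
    ((dyadicCutoff ρ N ((2 * Real.pi) • η) : ℝ) : ℂ) * 𝓕 g η with hM
  have hcont : Continuous M := by
    have := hρ.smooth.continuous
    have := continuous_fourier hg
    simp only [hM, dyadicCutoff]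
    fun_prop
  -- Compact support makes `M` integrable, so that Plancherel applies to its inverse Fourier
  -- integral.
  have hMs : HasCompactSupport M := by
    have hpi := Real.pi_pos
    refine HasCompactSupport.of_support_subset_isCompact
      (isCompact_closedBall (0 : Plane) (N * 2)) fun η hη => ?_
    by_contra hout
    simp only [Metric.mem_closedBall, dist_zero_right, not_le] at hout
    have hz : ∀ ζ : Plane, 2 ≤ ‖ζ‖ → ρ ζ = 0 := fun ζ hζ => by
      by_contra hne
      have := hρ.support (subset_tsupport ρ (Function.mem_support.2 hne))
      simp at this
      linarith
    have hN' : 2 ≤ N⁻¹ * ‖η‖ := by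
      rw [inv_mul_eq_div, le_div_iff₀ hN]; linarith
    have hpp : 1 ≤ 2 * Real.pi := by linarith [Real.pi_gt_three]
    apply hη
    simp only [hM, dyadicCutoff]
    rw [hz, hz]
    · simp
    · rw [norm_smul, norm_smul, Real.norm_of_nonneg (by positivity),
        Real.norm_of_nonneg (by positivity)]
      have : 2 / N * (2 * Real.pi * ‖η‖) = (N⁻¹ * ‖η‖) * (2 * (2 * Real.pi)) := by ring
      rw [this]
      nlinarith
    · rw [norm_smul, norm_smul, Real.norm_of_nonneg (by positivity),
        Real.norm_of_nonneg (by positivity)]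
      have : N⁻¹ * (2 * Real.pi * ‖η‖) = (N⁻¹ * ‖η‖) * (2 * Real.pi) := by ring
      rw [this]
      nlinarith
  have hsum := ((h 0).of_le_mul (h 0).1.norm zero_le_one
      (Filter.Eventually.of_forall fun η => by simp)).add
    ((h 1).of_le_mul (h 1).1.norm zero_le_one
      (Filter.Eventually.of_forall fun η => by simp)) (by positivity) (by positivity)
  have hb : L2Bound M ((A + 1) * N⁻¹ * (1 * c + 1 * c)) := by
    refine hsum.of_le_mul hcont.aestronglyMeasurable (by positivity)
      (Filter.Eventually.of_forall fun η => ?_)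
    have hpi := Real.pi_pos
    simp only [norm_derivSym]
    rw [Real.norm_of_nonneg (by positivity), hM, norm_mul, Complex.norm_real, Real.norm_eq_abs]
    have h1 := hlip ((2 * Real.pi) • η)
    rw [norm_smul, Real.norm_of_nonneg (by positivity)] at h1
    have h2 := norm_le_sum_coord η
    calc _ ≤ ((A + 1) * N⁻¹ * (2 * Real.pi * (|η 0| + |η 1|))) * ‖𝓕 g η‖ := by
          gcongr; exact h1.trans (by gcongr)
      _ = _ := by ring
  have hMi : Integrable M := hcont.integrable_of_hasCompactSupport hMs
  have hfin := (hb.fourierInv hMi).2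
  refine hfin.trans (ENNReal.ofReal_le_ofReal (le_of_eq ?_))
  ring

/-- A square integrable weight on the plane, comparable to `|ξ|^{-15/16}` near the origin and to
`|ξ|^{-31/16}` at infinity. -/
def freqWeight (y : ℝ) : ℝ := y ^ (1 / 16 : ℝ) / (y + y ^ 2)

lemma integrableOn_freqWeight :
    IntegrableOn (fun y : ℝ => y * freqWeight y ^ 2) (Set.Ioi 0) := by
  have hmeas : Measurable fun y : ℝ => y * freqWeight y ^ 2 := by
    unfold freqWeight
    fun_prop
  -- In polar coordinates the radial density is `y^(-7/8)` near 0 and decays faster than `y⁻²` at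
  -- infinity, so both ends are integrable.
  have key : ∀ y : ℝ, 0 < y → y * freqWeight y ^ 2 = y ^ (-(7 / 8) : ℝ) / (1 + y) ^ 2 := by
    intro y hy
    have h1 : (y ^ (1 / 16 : ℝ)) ^ 2 = y * y ^ (-(7 / 8) : ℝ) := by
      rw [← Real.rpow_natCast, ← Real.rpow_mul hy.le]
      nth_rw 2 [← Real.rpow_one y]
      rw [← Real.rpow_add hy]
      norm_num
    unfold freqWeight
    rw [div_pow, h1]
    field_simp
  rw [← Set.Ioc_union_Ioi_eq_Ioi (zero_le_one (α := ℝ))]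
  refine IntegrableOn.union ?_ ?_
  · have h : IntegrableOn (fun y : ℝ => y ^ (-(7 / 8) : ℝ)) (Set.Ioc 0 1) :=
      (intervalIntegral.intervalIntegrable_rpow' (by norm_num)).1
    refine h.mono' hmeas.aestronglyMeasurable ?_
    refine (ae_restrict_iff' measurableSet_Ioc).2 (Filter.Eventually.of_forall fun y hy => ?_)
    have hy0 : 0 < y := hy.1
    rw [key y hy0, Real.norm_of_nonneg (by positivity)]
    exact div_le_self (by positivity) (by nlinarith)
  · have h : IntegrableOn (fun y : ℝ => y ^ (-2 : ℝ)) (Set.Ioi 1) :=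
      integrableOn_Ioi_rpow_of_lt (by norm_num) one_pos
    refine h.mono' hmeas.aestronglyMeasurable ?_
    refine (ae_restrict_iff' measurableSet_Ioi).2 (Filter.Eventually.of_forall fun y hy => ?_)
    have hy1 : 1 < y := hy
    have hy0 : 0 < y := by linarith
    rw [key y hy0, Real.norm_of_nonneg (by positivity), Real.rpow_neg hy0.le 2, div_eq_mul_inv]
    have h1 : y ^ (-(7 / 8) : ℝ) ≤ 1 := Real.rpow_le_one_of_one_le_of_nonpos hy1.le (by norm_num)
    have h2 : ((1 + y) ^ 2)⁻¹ ≤ (y ^ (2 : ℝ))⁻¹ := by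
      rw [Real.rpow_two]
      gcongr
      linarith
    calc _ ≤ 1 * (y ^ (2 : ℝ))⁻¹ := by gcongr
      _ = _ := one_mul _

lemma exists_l2Bound_freqWeight :
    ∃ c, 0 ≤ c ∧ L2Bound (fun ξ : Plane => freqWeight ‖ξ‖) c := by
  have hmeas : Measurable freqWeight := by
    unfold freqWeight
    fun_prop
  have hm : AEStronglyMeasurable (fun ξ : Plane => freqWeight ‖ξ‖) volume :=
    (hmeas.comp measurable_norm).aestronglyMeasurable
  have h : MemLp (fun ξ : Plane => freqWeight ‖ξ‖) 2 volume := by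
    rw [memLp_two_iff_integrable_sq hm]
    refine (integrable_fun_norm_addHaar (volume : Measure Plane)
      (f := fun y => freqWeight y ^ 2)).2 ?_
    simpa using integrableOn_freqWeight
  exact ⟨_, ENNReal.toReal_nonneg, hm, (ENNReal.ofReal_toReal h.2.ne).ge⟩

/-- A function on the plane is controlled by its `L¹` norm and, up to a small power of the
frequency threshold `r`, by the `L²` norms of its first and second derivatives. -/
lemma exists_norm_le_of_fourier_l2Bound :
    ∃ C : ℝ, 0 < C ∧ ∀ (g : Plane → ℂ) (r A Y : ℝ), 0 < r → 0 ≤ Y →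
      Continuous g → Integrable g → ∫ x, ‖g x‖ ≤ A →
      L2Bound (fun ξ => ‖ξ‖ * ‖𝓕 g ξ‖) Y → L2Bound (fun ξ => ‖ξ‖ ^ 2 * ‖𝓕 g ξ‖) Y →
      ∀ x, ‖g x‖ ≤ C * (r ^ 2 * A + r ^ (-(1 / 16) : ℝ) * Y) := by
  obtain ⟨c, hc, hw⟩ := exists_l2Bound_freqWeight
  set V : ℝ := (volume (Metric.ball (0 : Plane) 1)).toReal with hV
  have hV0 : 0 ≤ V := ENNReal.toReal_nonneg
  refine ⟨V + 2 * c + 1, by positivity, fun g r A Y hr hY hgc hgi hA h1 h2 x => ?_⟩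
  have hA0 : 0 ≤ A := (integral_nonneg fun _ => norm_nonneg _).trans hA
  have hFc := continuous_fourier hgi
  have h12 := h1.add h2 hY hY
  obtain ⟨hi, hle⟩ := hw.integral_norm_mul_le h12 hc (by positivity)
  have hball : Integrable ((Metric.ball (0 : Plane) r).indicator fun _ => A) :=
    (integrable_indicator_iff measurableSet_ball).2 (integrableOn_const measure_ball_lt_top.ne)
  have hrp : 0 ≤ r ^ (-(1 / 16) : ℝ) := by positivity
  -- Below the threshold `r` the transform is at most the L¹ norm of `g`. Above it, `1 ≤ r^(-1/16)
  -- |ξ|^(1/16)`, and `|ξ|^(1/16)` is the weight times `|ξ| + |ξ|²`; Cauchy–Schwarz against the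
  -- weight then applies.
  have hpt : ∀ ξ : Plane, ‖𝓕 g ξ‖ ≤ (Metric.ball (0 : Plane) r).indicator (fun _ => A) ξ +
      r ^ (-(1 / 16) : ℝ) * (‖freqWeight ‖ξ‖‖ * ‖‖ξ‖ * ‖𝓕 g ξ‖ + ‖ξ‖ ^ 2 * ‖𝓕 g ξ‖‖) := by
    intro ξ
    by_cases hξ : ξ ∈ Metric.ball (0 : Plane) r
    · rw [Set.indicator_of_mem hξ]
      have := (norm_fourier_le g ξ).trans hA
      have : 0 ≤ r ^ (-(1 / 16) : ℝ) *
        (‖freqWeight ‖ξ‖‖ * ‖‖ξ‖ * ‖𝓕 g ξ‖ + ‖ξ‖ ^ 2 * ‖𝓕 g ξ‖‖) := by positivity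
      linarith
    · rw [Set.indicator_of_notMem hξ, zero_add]
      have hξr : r ≤ ‖ξ‖ := by simpa using hξ
      have hξ0 : 0 < ‖ξ‖ := hr.trans_le hξr
      have hfw : 0 ≤ freqWeight ‖ξ‖ := by unfold freqWeight; positivity
      rw [Real.norm_of_nonneg hfw, Real.norm_of_nonneg (by positivity), freqWeight]
      have e : ‖ξ‖ ^ (1 / 16 : ℝ) / (‖ξ‖ + ‖ξ‖ ^ 2) * (‖ξ‖ * ‖𝓕 g ξ‖ + ‖ξ‖ ^ 2 * ‖𝓕 g ξ‖) =
          ‖ξ‖ ^ (1 / 16 : ℝ) * ‖𝓕 g ξ‖ := by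
        field_simp
      rw [e, ← mul_assoc]
      have h3 : 1 ≤ r ^ (-(1 / 16) : ℝ) * ‖ξ‖ ^ (1 / 16 : ℝ) := by
        rw [Real.rpow_neg hr.le, ← div_eq_inv_mul, one_le_div (by positivity)]
        gcongr
      nlinarith [norm_nonneg (𝓕 g ξ)]
  have hdom := hball.add (hi.const_mul (r ^ (-(1 / 16) : ℝ)))
  have hFi : Integrable (𝓕 g) :=
    hdom.mono' hFc.aestronglyMeasurable (Filter.Eventually.of_forall hpt)
  have hinv := congrFun (hgc.fourierInv_fourier_eq hgi hFi) x
  have hVr : ∫ ξ : Plane, (Metric.ball (0 : Plane) r).indicator (fun _ => A) ξ = r ^ 2 * V * A := by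
    rw [integral_indicator_const A measurableSet_ball, smul_eq_mul, Measure.real,
      Measure.addHaar_ball_of_pos _ _ hr]
    simp [hV, ENNReal.toReal_mul, ENNReal.toReal_ofReal (pow_nonneg hr.le 2)]
  calc ‖g x‖ = ‖𝓕⁻ (𝓕 g) x‖ := by rw [hinv]
    _ ≤ ∫ ξ, ‖𝓕 g ξ‖ := norm_fourierInv_le _ _
    _ ≤ _ := integral_mono hFi.norm hdom hpt
    _ = r ^ 2 * V * A + r ^ (-(1 / 16) : ℝ) *
        ∫ ξ, (‖freqWeight ‖ξ‖‖ * ‖‖ξ‖ * ‖𝓕 g ξ‖ + ‖ξ‖ ^ 2 * ‖𝓕 g ξ‖‖) := by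
      simp only [Pi.add_apply]
      rw [integral_add hball (hi.const_mul _), hVr, integral_const_mul]
    _ ≤ r ^ 2 * V * A + r ^ (-(1 / 16) : ℝ) * (c * (Y + Y)) := by gcongr
    _ ≤ _ := by
      have e1 : 0 ≤ r ^ 2 * A := by positivity
      have e2 : 0 ≤ r ^ (-(1 / 16) : ℝ) * Y := by positivity
      nlinarith [mul_nonneg hc e1, mul_nonneg hV0 e2]

/-! ### Energy, group velocity and symbols. -/

/-- The relativistic energy `⟨2πη⟩`. -/
def energy (η : Plane) : ℝ := bracket ((2 * Real.pi) • η)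

/-- The components of the group velocity `2πη / ⟨2πη⟩`. -/
def vel (j : Fin 2) (η : Plane) : ℝ := 2 * Real.pi * η j / energy η

lemma one_le_energy (η : Plane) : 1 ≤ energy η := one_le_bracket _

lemma energy_pos (η : Plane) : 0 < energy η := bracket_pos _

lemma energy_sq (η : Plane) : energy η ^ 2 = 1 + (2 * Real.pi * ‖η‖) ^ 2 := by
  have hpi := Real.pi_pos
  rw [energy, bracket, Real.sq_sqrt (by positivity), norm_smul, Real.norm_of_nonneg (by positivity)]

lemma norm_sq_eq_coord (η : Plane) : ‖η‖ ^ 2 = η 0 ^ 2 + η 1 ^ 2 := by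
  rw [EuclideanSpace.norm_sq_eq, Fin.sum_univ_two]
  simp

lemma contDiff_energy : ContDiff ℝ ∞ energy := by
  unfold energy bracket
  refine ContDiff.sqrt ?_ fun η => by positivity
  exact contDiff_const.add ((contDiff_id.const_smul (2 * Real.pi)).norm_sq ℝ)

lemma continuous_energy : Continuous energy := contDiff_energy.continuous

lemma energy_mul_vel (j : Fin 2) (η : Plane) : energy η * vel j η = 2 * Real.pi * η j := by
  have := (energy_pos η).ne'
  unfold vel
  field_simp

lemma sum_vel_sq (η : Plane) : (vel 0 η ^ 2 + vel 1 η ^ 2) * energy η ^ 2 = energy η ^ 2 - 1 := by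
  have h : (vel 0 η ^ 2 + vel 1 η ^ 2) * energy η ^ 2 =
      (energy η * vel 0 η) ^ 2 + (energy η * vel 1 η) ^ 2 := by ring
  rw [h, energy_mul_vel, energy_mul_vel, energy_sq, mul_pow _ ‖η‖, norm_sq_eq_coord]
  ring

lemma abs_vel_le (j : Fin 2) (η : Plane) : |vel j η| ≤ 1 := by
  rw [vel, abs_div, abs_of_pos (energy_pos η), div_le_one (energy_pos η)]
  have := abs_coord_le_bracket ((2 * Real.pi) • η) j
  simpa [energy, abs_mul] using this

lemma contDiff_coord (j : Fin 2) : ContDiff ℝ ∞ fun η : Plane => η j :=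
  (EuclideanSpace.proj (𝕜 := ℝ) j : Plane →L[ℝ] ℝ).contDiff

lemma contDiff_vel (j : Fin 2) : ContDiff ℝ ∞ (vel j) :=
  (contDiff_const.mul (contDiff_coord j)).div contDiff_energy fun η => (energy_pos η).ne'

lemma energy_le {R : ℝ} (hR : 1 ≤ R) {η : Plane} (hη : ‖η‖ ≤ R) : energy η ≤ 8 * R := by
  refine abs_le_of_sq_le_sq' ?_ (by positivity) |>.2
  have h1 : 2 * Real.pi * ‖η‖ ≤ 6.3 * R := by
    have := Real.pi_lt_d2
    have := Real.pi_pos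
    nlinarith [norm_nonneg η]
  have h0 : 0 ≤ 2 * Real.pi * ‖η‖ := by positivity
  rw [energy_sq]
  nlinarith

/-- The partial derivative `∂_j`. -/
def pderiv (j : Fin 2) (a : Plane → ℝ) (η : Plane) : ℝ := fderiv ℝ a η (basisVec j)

lemma pderiv_mul {a b : Plane → ℝ} (ha : ContDiff ℝ ∞ a) (hb : ContDiff ℝ ∞ b) (j : Fin 2)
    (η : Plane) : pderiv j (fun η => a η * b η) η = a η * pderiv j b η + b η * pderiv j a η := by
  have h1 := (ha.differentiable (by simp)) η
  have h2 := (hb.differentiable (by simp)) η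
  unfold pderiv
  rw [fderiv_fun_mul h1 h2]
  simp

/-- Differentiating `E² = 1 + |2πη|²` avoids the square root; the factor `2E` is cancelled in
`pderiv_energy`. -/
lemma hasFDerivAt_energy_sq (η : Plane) (j : Fin 2) :
    2 * energy η * pderiv j energy η = 2 * energy η * (2 * Real.pi * vel j η) := by
  have h1 := (contDiff_energy.differentiable (by simp)) η
  have h2 : pderiv j (fun η => energy η * energy η) η = 2 * energy η * pderiv j energy η := by
    rw [pderiv_mul contDiff_energy contDiff_energy]; ring
  have h3 : (fun η => energy η * energy η) = fun η : Plane => 1 + (2 * Real.pi) ^ 2 * ‖η‖ ^ 2 := by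
    funext η
    rw [← pow_two, energy_sq]; ring
  rw [← h2, h3, pderiv, fderiv_const_add, fderiv_const_mul (differentiableAt_fun_id.norm_sq ℝ), fderiv_norm_sq]
  have : 2 * energy η * (2 * Real.pi * vel j η) = 2 * (2 * Real.pi) * (energy η * vel j η) := by
    ring
  rw [this, energy_mul_vel]
  simp [inner_basisVec]
  ring

lemma pderiv_energy (η : Plane) (j : Fin 2) : pderiv j energy η = 2 * Real.pi * vel j η :=
  mul_left_cancel₀ (mul_pos two_pos (energy_pos η)).ne' (hasFDerivAt_energy_sq η j)

lemma abs_pderiv_energy_le (η : Plane) (j : Fin 2) : |pderiv j energy η| ≤ 7 := by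
  rw [pderiv_energy, abs_mul, abs_of_pos (by positivity)]
  nlinarith [abs_vel_le j η, abs_nonneg (vel j η), Real.pi_lt_d2, Real.pi_pos]

lemma pderiv_coord (η : Plane) (j k : Fin 2) :
    pderiv j (fun η => η k) η = (basisVec j : Plane) k := by
  have : fderiv ℝ (fun η : Plane => η k) η = (EuclideanSpace.proj (𝕜 := ℝ) k : Plane →L[ℝ] ℝ) :=
    (EuclideanSpace.proj (𝕜 := ℝ) k : Plane →L[ℝ] ℝ).hasFDerivAt.fderiv
  rw [pderiv, this]
  rfl

lemma abs_pderiv_coord_le (η : Plane) (j k : Fin 2) : |pderiv j (fun η => η k) η| ≤ 1 := by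
  rw [pderiv_coord]
  exact (PiLp.norm_apply_le (basisVec j) k).trans (norm_basisVec j).le

/-- Differentiate `E V_k = 2πη_k`: the right side and the term `V_k ∂_j E` contribute at most 7
each, and `E ≥ 1`. -/
lemma abs_pderiv_vel_le (η : Plane) (j k : Fin 2) : |pderiv j (vel k) η| ≤ 14 := by
  have h1 : pderiv j (fun η => energy η * vel k η) η = 2 * Real.pi * pderiv j (fun η => η k) η := by
    have : (fun η => energy η * vel k η) = fun η : Plane => 2 * Real.pi * η k :=
      funext fun η => energy_mul_vel k η
    rw [this, pderiv_mul contDiff_const (contDiff_coord k)]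
    simp [pderiv]
  rw [pderiv_mul contDiff_energy (contDiff_vel k)] at h1
  have h2 : |energy η * pderiv j (vel k) η| ≤ 14 := by
    have e : energy η * pderiv j (vel k) η =
        2 * Real.pi * pderiv j (fun η => η k) η - vel k η * pderiv j energy η := by linarith
    have a1 : |2 * Real.pi * pderiv j (fun η => η k) η| ≤ 7 := by
      rw [abs_mul, abs_of_pos (by positivity)]
      nlinarith [abs_pderiv_coord_le η j k, Real.pi_lt_d2, Real.pi_pos]
    have a2 : |vel k η * pderiv j energy η| ≤ 7 := by
      rw [abs_mul]
      nlinarith [abs_vel_le k η, abs_pderiv_energy_le η j, abs_nonneg (vel k η)]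
    rw [e]
    exact (abs_sub _ _).trans (by linarith)
  rw [abs_mul, abs_of_pos (energy_pos η)] at h2
  nlinarith [one_le_energy η, abs_nonneg (pderiv j (vel k) η)]

/-- A continuous symbol supported in the ball of radius `R` and bounded by `N`. -/
structure BddSymbol (R N : ℝ) (m : Plane → ℝ) : Prop where
  cont : Continuous m
  zero : ∀ η, R < ‖η‖ → m η = 0
  bound : ∀ η, |m η| ≤ N

/-- A smooth symbol supported in the ball of radius `R`, and bounded by `N` together with its
first derivatives. -/
structure SmoothSymbol (R N : ℝ) (m : Plane → ℝ) : Prop where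
  smooth : ContDiff ℝ ∞ m
  zero : ∀ η, R < ‖η‖ → m η = 0
  bound : ∀ η, |m η| ≤ N
  deriv_bound : ∀ j η, |pderiv j m η| ≤ N

namespace SmoothSymbol

variable {R N : ℝ} {m : Plane → ℝ}

lemma nonneg (h : SmoothSymbol R N m) : 0 ≤ N := (abs_nonneg _).trans (h.bound 0)

lemma bdd (h : SmoothSymbol R N m) : BddSymbol R N m := ⟨h.smooth.continuous, h.zero, h.bound⟩

lemma pderiv_zero (h : SmoothSymbol R N m) (j : Fin 2) {η : Plane} (hη : R < ‖η‖) :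
    pderiv j m η = 0 := by
  have : m =ᶠ[nhds η] fun _ => 0 := by
    filter_upwards [continuous_norm.continuousAt.eventually_const_lt hη] with ζ hζ
    exact h.zero ζ hζ
  rw [pderiv, this.fderiv_eq]
  simp

lemma bdd_pderiv (h : SmoothSymbol R N m) (j : Fin 2) : BddSymbol R N (pderiv j m) := by
  refine ⟨?_, fun η hη => h.pderiv_zero j hη, h.deriv_bound j⟩
  exact (h.smooth.continuous_fderiv (by simp)).clm_apply continuous_const

/-- The support of `m` is why the multiplier needs bounds only for `|η| ≤ R`; this admits unbounded
factors such as the energy, at the price of a power of `R`. -/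
lemma mul {a : Plane → ℝ} {c d : ℝ} (h : SmoothSymbol R N m) (ha : ContDiff ℝ ∞ a) (hd : 0 ≤ d)
    (hc0 : 0 ≤ c)
    (hc : ∀ η, ‖η‖ ≤ R → |a η| ≤ c) (hd' : ∀ j η, ‖η‖ ≤ R → |pderiv j a η| ≤ d) :
    SmoothSymbol R ((c + d) * N) fun η => a η * m η := by
  have hN := h.nonneg
  refine ⟨ha.mul h.smooth, fun η hη => by simp [h.zero η hη], fun η => ?_, fun j η => ?_⟩
  · by_cases hη : ‖η‖ ≤ R
    · rw [abs_mul]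
      calc |a η| * |m η| ≤ c * N := mul_le_mul (hc η hη) (h.bound η) (abs_nonneg _) hc0
        _ ≤ _ := by nlinarith
    · rw [h.zero η (not_le.1 hη)]
      simp only [mul_zero, abs_zero]
      positivity
  · rw [pderiv_mul ha h.smooth]
    by_cases hη : ‖η‖ ≤ R
    · refine (abs_add_le _ _).trans ?_
      rw [abs_mul, abs_mul]
      calc |a η| * |pderiv j m η| + |m η| * |pderiv j a η| ≤ c * N + N * d := by
            gcongr
            · exact hc η hη
            · exact h.deriv_bound j η
            · exact h.bound η
            · exact hd' j η hη
        _ = _ := by ring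
    · rw [h.zero η (not_le.1 hη), h.pderiv_zero j (not_le.1 hη)]
      simp only [mul_zero, zero_mul, abs_zero, add_zero]
      positivity

lemma energy_mul (h : SmoothSymbol R N m) (hR : 1 ≤ R) :
    SmoothSymbol R (15 * R * N) fun η => energy η * m η := by
  have := h.mul (c := 8 * R) (d := 7 * R) contDiff_energy (by positivity) (by positivity)
    (fun η hη => by rw [abs_of_pos (energy_pos η)]; exact energy_le hR hη)
    (fun j η _ => (abs_pderiv_energy_le η j).trans (by linarith))
  convert this using 1
  ring

lemma vel_mul (h : SmoothSymbol R N m) (j : Fin 2) :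
    SmoothSymbol R (15 * N) fun η => vel j η * m η := by
  have := h.mul (c := 1) (d := 14) (contDiff_vel j) (by positivity) (by positivity)
    (fun η _ => abs_vel_le j η) (fun k η _ => abs_pderiv_vel_le η k j)
  convert this using 1
  ring

lemma coord_mul (h : SmoothSymbol R N m) (hR : 1 ≤ R) (k : Fin 2) :
    SmoothSymbol R (2 * R * N) fun η => η k * m η := by
  have := h.mul (c := R) (d := R) (contDiff_coord k) (by positivity) (by positivity)
    (fun η hη => (PiLp.norm_apply_le η k).trans hη)
    (fun j η _ => (abs_pderiv_coord_le η j k).trans hR)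
  convert this using 1
  ring

/-- A derivative of the damping factor produces `l e^{-l}`, since `E ≥ 1`; half of the exponential
absorbs the factor `l`. The densities are bilinear, so two factors `e^{-l/2}` restore `e^{-l}`. -/
lemma exp_mul (h : SmoothSymbol R N m) {l : ℝ} (hl : 0 ≤ l) :
    SmoothSymbol R (16 * Real.exp (-l / 2) * N) fun η => Real.exp (-l * energy η) * m η := by
  have hs : ContDiff ℝ ∞ fun η => Real.exp (-l * energy η) :=
    Real.contDiff_exp.comp (contDiff_const.mul contDiff_energy)
  have hle : ∀ η, Real.exp (-l * energy η) ≤ Real.exp (-l) := fun η => by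
    refine Real.exp_le_exp.2 ?_
    nlinarith [one_le_energy η]
  have hd : ∀ j η, |pderiv j (fun η => Real.exp (-l * energy η)) η| ≤ 7 * l * Real.exp (-l) := by
    intro j η
    have hE := (contDiff_energy.differentiable (by simp)) η
    have e : pderiv j (fun η => Real.exp (-l * energy η)) η =
        Real.exp (-l * energy η) * (-l * pderiv j energy η) := by
      unfold pderiv
      rw [fderiv_exp (hE.const_mul _), fderiv_const_mul hE]
      simp
    rw [e, abs_mul, Real.abs_exp, abs_mul, abs_neg, abs_of_nonneg hl]
    have h7 := abs_pderiv_energy_le η j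
    calc _ ≤ Real.exp (-l) * (l * 7) :=
          mul_le_mul (hle η) (by gcongr) (by positivity) (Real.exp_pos _).le
      _ = _ := by ring
  have hN := h.nonneg
  have key := h.mul (c := Real.exp (-l)) (d := 7 * l * Real.exp (-l)) hs (by positivity)
    (by positivity) (fun η _ => by rw [Real.abs_exp]; exact hle η) (fun j η _ => hd j η)
  have hmono : (Real.exp (-l) + 7 * l * Real.exp (-l)) * N ≤ 16 * Real.exp (-l / 2) * N := by
    gcongr
    have e1 : Real.exp (-l) = Real.exp (-l / 2) * Real.exp (-l / 2) := by
      rw [← Real.exp_add]; congr 1; ring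
    have e2 : Real.exp (l / 2) * Real.exp (-l / 2) = 1 := by
      rw [← Real.exp_add]; ring_nf; simp
    have e3 := Real.add_one_le_exp (l / 2)
    have e4 : 0 < Real.exp (-l / 2) := Real.exp_pos _
    have e5 : (l / 2 + 1) * Real.exp (-l / 2) ≤ 1 := by
      calc _ ≤ Real.exp (l / 2) * Real.exp (-l / 2) := by gcongr
        _ = 1 := e2
    rw [e1]
    nlinarith
  exact ⟨key.smooth, key.zero, fun η => (key.bound η).trans hmono,
    fun j η => (key.deriv_bound j η).trans hmono⟩

end SmoothSymbol

/-! ### Free waves and the action of `x` on them. -/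

/-- The oscillating factor of the free evolution on the Fourier side. -/
def osc (τ : ℝ) (η : Plane) : ℂ := Complex.exp (((-(τ * energy η) : ℝ) : ℂ) * Complex.I)

lemma norm_osc (τ : ℝ) (η : Plane) : ‖osc τ η‖ = 1 := Complex.norm_exp_ofReal_mul_I _

lemma continuous_osc (τ : ℝ) : Continuous (osc τ) := by
  have := continuous_energy
  unfold osc
  fun_prop

/-- The frequency side of the free wave with profile `v`, localised by the symbol `m`. -/
def waveSym (τ : ℝ) (m : Plane → ℝ) (v : Plane → Spinor) (η : Plane) : Spinor :=
  (osc τ η * (m η : ℂ)) • v η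

/-- The free wave with profile `v`, localised by the symbol `m`. -/
def freeWave (τ : ℝ) (m : Plane → ℝ) (v : Plane → Spinor) : Plane → Spinor :=
  𝓕⁻ (waveSym τ m v)

lemma norm_waveSym (τ : ℝ) (m : Plane → ℝ) (v : Plane → Spinor) (η : Plane) :
    ‖waveSym τ m v η‖ = |m η| * ‖v η‖ := by
  rw [waveSym, norm_smul, norm_mul, norm_osc, one_mul, Complex.norm_real, Real.norm_eq_abs]

namespace BddSymbol

variable {R N X : ℝ} {m : Plane → ℝ} {v : Plane → Spinor}

lemma nonneg (h : BddSymbol R N m) : 0 ≤ N := (abs_nonneg _).trans (h.bound 0)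

lemma aestronglyMeasurable (hm : BddSymbol R N m) (hv : AEStronglyMeasurable v volume) (τ : ℝ) :
    AEStronglyMeasurable (waveSym τ m v) volume := by
  have h1 := continuous_osc τ
  have h2 := hm.cont
  exact (by fun_prop : Continuous fun η => osc τ η * (m η : ℂ)).aestronglyMeasurable.smul hv

lemma l2Bound (hm : BddSymbol R N m) (hv : L2Bound v X) (τ : ℝ) :
    L2Bound (waveSym τ m v) (N * X) :=
  hv.of_le_mul (hm.aestronglyMeasurable hv.1 τ) hm.nonneg (Filter.Eventually.of_forall fun η => by
    rw [norm_waveSym]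
    exact mul_le_mul_of_nonneg_right (hm.bound η) (norm_nonneg _))

end BddSymbol

/-- Cauchy–Schwarz against the indicator of the ball of radius `R`. The dependence of `c` on `R` is
immaterial: the bound serves only to provide integrability and finiteness. -/
lemma exists_integral_norm_waveSym_le (R : ℝ) : ∃ c : ℝ, 0 ≤ c ∧
    ∀ (N X τ : ℝ) (m : Plane → ℝ) (v : Plane → Spinor), 0 ≤ X → BddSymbol R N m → L2Bound v X →
      Integrable (waveSym τ m v) ∧ ∫ η, ‖waveSym τ m v η‖ ≤ c * N * X := by
  set χ : Plane → ℝ := (Metric.closedBall (0 : Plane) R).indicator fun _ => 1 with hχ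
  have hm : MemLp χ 2 volume := memLp_indicator_const 2 measurableSet_closedBall 1
    (Or.inr measure_closedBall_lt_top.ne)
  have hb : L2Bound χ (eLpNorm χ 2 volume).toReal := ⟨hm.1, (ENNReal.ofReal_toReal hm.2.ne).ge⟩
  refine ⟨(eLpNorm χ 2 volume).toReal, ENNReal.toReal_nonneg, fun N X τ m v hX hm hv => ?_⟩
  have hN := hm.nonneg
  obtain ⟨h1, h2⟩ := hb.integral_norm_mul_le (hm.l2Bound hv τ) ENNReal.toReal_nonneg
    (by positivity)
  have e : ∀ η, ‖χ η‖ * ‖waveSym τ m v η‖ = ‖waveSym τ m v η‖ := fun η => by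
    by_cases hη : η ∈ Metric.closedBall (0 : Plane) R
    · simp [hχ, hη]
    · rw [norm_waveSym, hm.zero η (by simpa using hη)]
      simp
  simp only [e] at h1 h2
  exact ⟨(integrable_norm_iff (hm.aestronglyMeasurable hv.1 τ)).1 h1, by rwa [mul_assoc]⟩

namespace BddSymbol

variable {R N X : ℝ} {m : Plane → ℝ} {v : Plane → Spinor}

lemma intSq (hm : BddSymbol R N m) (hX : 0 ≤ X) (hv : L2Bound v X) (τ : ℝ) :
    IntSq (waveSym τ m v) := by
  obtain ⟨c, -, h⟩ := exists_integral_norm_waveSym_le R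
  exact ⟨(h N X τ m v hX hm hv).1, (hm.l2Bound hv τ).memLp⟩

lemma l2Bound_freeWave (hm : BddSymbol R N m) (hX : 0 ≤ X) (hv : L2Bound v X) (τ : ℝ) :
    L2Bound (freeWave τ m v) (N * X) :=
  (hm.l2Bound hv τ).fourierInv (hm.intSq hX hv τ).int

end BddSymbol

/-- A square integrable profile `v` with square integrable weak gradient `2πi w`. -/
structure Profile (v : Plane → Spinor) (w : Fin 2 → Plane → Spinor) (X : ℝ) : Prop where
  nonneg : 0 ≤ X
  meas : StronglyMeasurable v
  bound : L2Bound v X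
  grad_bound : ∀ j, L2Bound (w j) X
  weak_grad : ∀ Φ : Plane → ℂ, ContDiff ℝ ∞ Φ → HasCompactSupport Φ → ∀ j,
    ∫ η, fderiv ℝ Φ η (basisVec j) • v η = (2 * Real.pi * Complex.I) • ∫ η, Φ η • w j η

lemma integrable_exp_smul {G : Plane → Spinor} (hG : Integrable G) (x : Plane) :
    Integrable fun η => Complex.exp (((2 * Real.pi * inner ℝ η x : ℝ) : ℂ) * Complex.I) • G η := by
  refine hG.norm.mono' ?_ (Filter.Eventually.of_forall fun η => ?_)
  · exact (by fun_prop : Continuous fun η : Plane =>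
      Complex.exp (((2 * Real.pi * inner ℝ η x : ℝ) : ℂ) * Complex.I)).aestronglyMeasurable.smul
        hG.1
  · rw [norm_smul, Complex.norm_exp_ofReal_mul_I, one_mul]

lemma hasCompactSupport_of_zero {E : Type*} [Zero E] {R : ℝ} {Φ : Plane → E}
    (h : ∀ η, R < ‖η‖ → Φ η = 0) : HasCompactSupport Φ :=
  HasCompactSupport.of_support_subset_isCompact (isCompact_closedBall (0 : Plane) R) fun η hη => by
    by_contra hout
    exact hη (h η (by simpa using hout))

section

variable {R N : ℝ} {m : Plane → ℝ}

/-- The phase-space test function whose gradient generates the action of `x` on a free wave. -/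
lemma fderiv_exp_osc_symbol (hm : ContDiff ℝ ∞ m) (τ : ℝ) (x η : Plane) (j : Fin 2) :
    fderiv ℝ (fun η : Plane => Complex.exp (((2 * Real.pi * inner ℝ η x : ℝ) : ℂ) * Complex.I) *
        (osc τ η * (m η : ℂ))) η (basisVec j) =
      Complex.exp (((2 * Real.pi * inner ℝ η x : ℝ) : ℂ) * Complex.I) * (osc τ η *
        ((2 * Real.pi * Complex.I * (x j : ℂ)) * (m η : ℂ) -
          (2 * Real.pi * Complex.I * (τ : ℂ)) * ((vel j η * m η : ℝ) : ℂ) +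
          (pderiv j m η : ℂ))) := by
  set p : Plane → ℝ := fun η => 2 * Real.pi * inner ℝ η x + -(τ * energy η) with hp
  have hdE := (contDiff_energy.differentiable (by simp)) η
  have hin : HasFDerivAt (fun η : Plane => inner ℝ η x) (innerSL ℝ x) η := by
    have := (innerSL ℝ x).hasFDerivAt (x := η)
    refine this.congr_of_eventuallyEq (Filter.Eventually.of_forall fun ζ => ?_)
    simp [real_inner_comm]
  have hpd : HasFDerivAt p ((2 * Real.pi) • innerSL ℝ x + -(τ • fderiv ℝ energy η)) η :=
    (hin.const_mul _).add (hdE.hasFDerivAt.const_mul τ).neg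
  have hmd := ((hm.differentiable (by simp)) η).hasFDerivAt
  have hpc := (Complex.ofRealCLM.hasFDerivAt.comp η hpd).mul_const Complex.I
  have hmc := Complex.ofRealCLM.hasFDerivAt.comp η hmd
  have hE := hpc.cexp.mul hmc
  have e : (fun η : Plane => Complex.exp (((2 * Real.pi * inner ℝ η x : ℝ) : ℂ) * Complex.I) *
      (osc τ η * (m η : ℂ))) =
      fun η => Complex.exp (((Complex.ofRealCLM ∘ p) η) * Complex.I) *
        (Complex.ofRealCLM ∘ m) η := by
    funext ζ
    rw [osc, ← mul_assoc, ← Complex.exp_add]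
    simp [hp, add_mul]
  have e2 : Complex.exp ((Complex.ofRealCLM ∘ p) η * Complex.I) =
      Complex.exp (((2 * Real.pi * inner ℝ η x : ℝ) : ℂ) * Complex.I) * osc τ η := by
    rw [osc, ← Complex.exp_add]
    simp [hp, add_mul]
  have e3 : fderiv ℝ energy η (basisVec j) = 2 * Real.pi * vel j η := pderiv_energy η j
  rw [e]
  refine (congrArg (fun A => A (basisVec j)) hE.fderiv).trans ?_
  rw [e2]
  simp only [add_apply, smul_apply, neg_apply, ContinuousLinearMap.comp_apply,
    innerSL_apply_apply, inner_basisVec, e3, Function.comp_apply, Complex.ofRealCLM_apply,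
    smul_eq_mul, pderiv]
  push_cast
  ring

/-- Multiplication by `x` on a free wave: up to an error controlled by the gradient of the profile,
it is the multiplication by `τ` times the group velocity. -/
lemma coord_smul_freeWave {v : Plane → Spinor} {w : Fin 2 → Plane → Spinor} {X : ℝ}
    (h : Profile v w X) (hm : SmoothSymbol R N m) (τ : ℝ) (j : Fin 2) (x : Plane) :
    (2 * Real.pi * Complex.I * (x j : ℂ)) • freeWave τ m v x =
      ((2 * Real.pi * Complex.I) • freeWave τ m (w j) x - freeWave τ (pderiv j m) v x) +
        (2 * Real.pi * Complex.I * (τ : ℂ)) • freeWave τ (fun η => vel j η * m η) v x := by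
  set Φ : Plane → ℂ := fun η =>
    Complex.exp (((2 * Real.pi * inner ℝ η x : ℝ) : ℂ) * Complex.I) * (osc τ η * (m η : ℂ)) with hΦ
  have hΦs : ContDiff ℝ ∞ Φ := by
    have h1 := contDiff_energy
    have h2 := hm.smooth
    have h3 : ContDiff ℝ ∞ fun η : Plane => ((2 * Real.pi * inner ℝ η x : ℝ) : ℂ) :=
      Complex.ofRealCLM.contDiff.comp (contDiff_const.mul (contDiff_id.inner ℝ contDiff_const))
    have h4 : ContDiff ℝ ∞ fun η : Plane => ((-(τ * energy η) : ℝ) : ℂ) :=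
      Complex.ofRealCLM.contDiff.comp (contDiff_const.mul h1).neg
    have h5 : ContDiff ℝ ∞ fun η : Plane => (m η : ℂ) := Complex.ofRealCLM.contDiff.comp h2
    exact (h3.mul contDiff_const).cexp.mul ((h4.mul contDiff_const).cexp.mul h5)
  have hΦc : HasCompactSupport Φ := hasCompactSupport_of_zero (R := R) fun η hη => by
    simp [hΦ, hm.zero η hη]
  -- The `η_j`-derivative of the test function brings down `x_j` from the character, `-τ V_j` from
  -- the oscillation and `∂_j m` from the symbol; the weak gradient of the profile accounts for the
  -- other side.
  have key := h.weak_grad Φ hΦs hΦc j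
  have i1 := integrable_exp_smul (hm.bdd.intSq h.nonneg h.bound τ).int x
  have i2 := integrable_exp_smul ((hm.vel_mul j).bdd.intSq h.nonneg h.bound τ).int x
  have i3 := integrable_exp_smul ((hm.bdd_pderiv j).intSq h.nonneg h.bound τ).int x
  have e1 : ∀ η, fderiv ℝ Φ η (basisVec j) • v η =
      ((2 * Real.pi * Complex.I * (x j : ℂ)) •
        (Complex.exp (((2 * Real.pi * inner ℝ η x : ℝ) : ℂ) * Complex.I) • waveSym τ m v η) -
      (2 * Real.pi * Complex.I * (τ : ℂ)) •
        (Complex.exp (((2 * Real.pi * inner ℝ η x : ℝ) : ℂ) * Complex.I) •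
          waveSym τ (fun η => vel j η * m η) v η)) +
      Complex.exp (((2 * Real.pi * inner ℝ η x : ℝ) : ℂ) * Complex.I) •
        waveSym τ (pderiv j m) v η := fun η => by
    rw [hΦ, fderiv_exp_osc_symbol hm.smooth]
    simp only [waveSym, smul_smul, ← sub_smul, ← add_smul]
    congr 1
    ring
  have e2 : ∀ η, Φ η • w j η =
      Complex.exp (((2 * Real.pi * inner ℝ η x : ℝ) : ℂ) * Complex.I) •
        waveSym τ m (w j) η := fun η => by
    simp only [hΦ, waveSym, smul_smul]
  have hsplit := integral_add ((i1.smul (2 * Real.pi * Complex.I * (x j : ℂ))).sub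
    (i2.smul (2 * Real.pi * Complex.I * (τ : ℂ)))) i3
  have hsplit2 := integral_sub (i1.smul (2 * Real.pi * Complex.I * (x j : ℂ)))
    (i2.smul (2 * Real.pi * Complex.I * (τ : ℂ)))
  simp only [Pi.smul_apply, Pi.sub_apply] at hsplit hsplit2
  simp only [e1, e2] at key
  rw [hsplit, hsplit2, integral_smul, integral_smul] at key
  simp only [freeWave, Real.fourierInv_eq']
  rw [← key]
  abel

end

/-! ### Commutators with the velocity and with the energy. -/

/-- Minkowski's integral inequality for an exponentially decaying family. -/
lemma l2Bound_integral_Ioi {S : ℝ → Plane → ℂ} {C : ℝ} (hC : 0 ≤ C)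
    (hS : StronglyMeasurable (Function.uncurry S))
    (h : ∀ l, 0 < l → L2Bound (S l) (C * Real.exp (-l))) :
    L2Bound (fun x => ∫ l in Set.Ioi (0 : ℝ), S l x) C := by
  have hS' : StronglyMeasurable (Function.uncurry fun x l => S l x) :=
    hS.comp_measurable measurable_swap
  have hm : StronglyMeasurable fun x => ∫ l in Set.Ioi (0 : ℝ), S l x :=
    hS'.integral_prod_right
  have hexp : ∫⁻ l in Set.Ioi (0 : ℝ), ENNReal.ofReal (Real.exp (-l)) = 1 := by
    rw [← ofReal_integral_eq_lintegral_ofReal (integrableOn_exp_neg_Ioi 0)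
      (Filter.Eventually.of_forall fun l => (Real.exp_pos _).le), integral_exp_neg_Ioi]
    simp
  have hen : Measurable fun p : Plane × ℝ => ‖S p.2 p.1‖ₑ := hS'.enorm
  have hpt : ∀ x, ‖∫ l in Set.Ioi (0 : ℝ), S l x‖ₑ ^ (2 : ℝ) ≤
      ∫⁻ l in Set.Ioi (0 : ℝ), ENNReal.ofReal (Real.exp l) * ‖S l x‖ₑ ^ (2 : ℝ) := fun x => by
    have hmx : Measurable fun l => ‖S l x‖ₑ := hen.comp measurable_prodMk_left
    -- Cauchy–Schwarz in `l` after writing `1 = e^{-l/2} e^{l/2}`; the first factor has L² norm 1 on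
    -- the half-line.
    have h1 : ∫⁻ l in Set.Ioi (0 : ℝ), ‖S l x‖ₑ ≤
        (∫⁻ l in Set.Ioi (0 : ℝ), ENNReal.ofReal (Real.exp (-l / 2)) ^ (2 : ℝ)) ^ (1 / 2 : ℝ) *
        (∫⁻ l in Set.Ioi (0 : ℝ),
          (ENNReal.ofReal (Real.exp (l / 2)) * ‖S l x‖ₑ) ^ (2 : ℝ)) ^ (1 / 2 : ℝ) := by
      refine le_trans (le_of_eq ?_) (ENNReal.lintegral_mul_le_Lp_mul_Lq _
        Real.HolderConjugate.two_two (by fun_prop) (by fun_prop))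
      refine lintegral_congr fun l => ?_
      simp only [Pi.mul_apply]
      rw [← mul_assoc, ← ENNReal.ofReal_mul (Real.exp_pos _).le, ← Real.exp_add]
      ring_nf
      simp
    have e1 : ∀ l : ℝ, ENNReal.ofReal (Real.exp (-l / 2)) ^ (2 : ℝ) =
        ENNReal.ofReal (Real.exp (-l)) := fun l => by
      rw [ENNReal.ofReal_rpow_of_pos (Real.exp_pos _), ← Real.exp_mul]
      ring_nf
    have e2 : ∀ l : ℝ, (ENNReal.ofReal (Real.exp (l / 2)) * ‖S l x‖ₑ) ^ (2 : ℝ) =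
        ENNReal.ofReal (Real.exp l) * ‖S l x‖ₑ ^ (2 : ℝ) := fun l => by
      rw [ENNReal.mul_rpow_of_nonneg _ _ (by norm_num),
        ENNReal.ofReal_rpow_of_pos (Real.exp_pos _), ← Real.exp_mul]
      ring_nf
    simp only [e1, e2, hexp, ENNReal.one_rpow, one_mul] at h1
    have h2 := (enorm_integral_le_lintegral_enorm (μ := volume.restrict (Set.Ioi (0 : ℝ)))
      fun l => S l x).trans h1
    refine (ENNReal.rpow_le_rpow h2 (by norm_num)).trans (le_of_eq ?_)
    rw [← ENNReal.rpow_mul]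
    norm_num
  refine ⟨hm.aestronglyMeasurable, ?_⟩
  have hsq : ∫⁻ x, ‖∫ l in Set.Ioi (0 : ℝ), S l x‖ₑ ^ (2 : ℝ) ≤ ENNReal.ofReal C ^ (2 : ℝ) := by
    calc _ ≤ ∫⁻ x, ∫⁻ l in Set.Ioi (0 : ℝ), ENNReal.ofReal (Real.exp l) * ‖S l x‖ₑ ^ (2 : ℝ) :=
          lintegral_mono hpt
      _ = ∫⁻ l in Set.Ioi (0 : ℝ), ∫⁻ x, ENNReal.ofReal (Real.exp l) * ‖S l x‖ₑ ^ (2 : ℝ) := by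
          refine lintegral_lintegral_swap (Measurable.aemeasurable ?_)
          simp only [Function.uncurry_def]
          fun_prop
      _ ≤ ∫⁻ l in Set.Ioi (0 : ℝ), ENNReal.ofReal (Real.exp (-l)) * ENNReal.ofReal C ^ (2 : ℝ) := by
          refine setLIntegral_mono (by fun_prop) fun l hl => ?_
          rw [lintegral_const_mul' _ _ ENNReal.ofReal_ne_top]
          have h2 := (h l hl).2
          rw [eLpNorm_two_eq] at h2
          have h3 := ENNReal.rpow_le_rpow h2 (by norm_num : (0 : ℝ) ≤ 2)
          rw [← ENNReal.rpow_mul] at h3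
          norm_num only [ENNReal.rpow_one] at h3
          refine (mul_le_mul_right h3 _).trans (le_of_eq ?_)
          rw [ENNReal.ofReal_mul hC, ENNReal.mul_rpow_of_nonneg _ _ (by norm_num),
            ENNReal.ofReal_rpow_of_pos (Real.exp_pos _), ← Real.exp_mul, mul_left_comm,
            ← ENNReal.ofReal_mul (Real.exp_pos _).le, ← Real.exp_add, mul_comm]
          ring_nf
      _ = ENNReal.ofReal C ^ (2 : ℝ) := by
          rw [lintegral_mul_const _ (by fun_prop), hexp, one_mul]
  rw [eLpNorm_two_eq]
  refine (ENNReal.rpow_le_rpow hsq (by norm_num)).trans (le_of_eq ?_)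
  rw [← ENNReal.rpow_mul]
  norm_num

/-- The free waves with symbols of size `N` are bounded by `A * N`. -/
def SupBound (τ R A : ℝ) (v : Plane → Spinor) : Prop :=
  ∀ (m : Plane → ℝ) (N : ℝ), SmoothSymbol R N m → ∀ x, ‖freeWave τ m v x‖ ≤ A * N

/-- The commutator density `⟨u_m, L u_{a n}⟩ - ⟨u_{a m}, L u_n⟩` of free waves. -/
def commDensity (L : Spinor →L[ℂ] Spinor) (τ : ℝ) (v : Plane → Spinor) (a m n : Plane → ℝ)
    (x : Plane) : ℂ :=
  cross L (freeWave τ m v) (freeWave τ (fun η => a η * n η) v) x -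
    cross L (freeWave τ (fun η => a η * m η) v) (freeWave τ n v) x

section

variable {R N N' X A τ : ℝ} {m n : Plane → ℝ} {v : Plane → Spinor}
  {w : Fin 2 → Plane → Spinor}

lemma continuous_freeWave (hm : BddSymbol R N m) (hX : 0 ≤ X) (hv : L2Bound v X) :
    Continuous (freeWave τ m v) := continuous_fourierInv (hm.intSq hX hv τ).int

lemma freeWave_add (hm : BddSymbol R N m) (hn : BddSymbol R N' n) (hX : 0 ≤ X)
    (hv : L2Bound v X) (x : Plane) :
    freeWave τ (fun η => m η + n η) v x = freeWave τ m v x + freeWave τ n v x := by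
  have i1 := integrable_exp_smul (hm.intSq hX hv τ).int x
  have i2 := integrable_exp_smul (hn.intSq hX hv τ).int x
  simp only [freeWave, Real.fourierInv_eq']
  rw [← integral_add i1 i2]
  refine integral_congr_ae (Filter.Eventually.of_forall fun η => ?_)
  simp only [waveSym, ← smul_add, ← add_smul]
  congr 2
  push_cast
  ring

/-- Since `x_j` is real, moving it from one entry to the other changes nothing. Substituting `x_j =
τ V_j + error` on each wave leaves `τ` times the velocity commutator equal to two error terms, each
estimated with the error in L² and the other wave in L^∞. The cancellation is pointwise in `x`, so
no integrability of `x_j u` is needed. -/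
lemma l2Bound_commDensity_vel (hp : Profile v w X) (hA : SupBound τ R A v) (hτ : τ ≠ 0)
    (hm : SmoothSymbol R N m) (hn : SmoothSymbol R N' n) (L : Spinor →L[ℂ] Spinor) (j : Fin 2) :
    L2Bound (commDensity L τ v (vel j) m n) (3 * ‖L‖ * X * A * N * N' / |τ|) := by
  have hX := hp.nonneg
  have hN := hm.nonneg
  have hN' := hn.nonneg
  have hpi := Real.pi_pos
  have hτ' : 0 < |τ| := abs_pos.2 hτ
  set E : (Plane → ℝ) → Plane → Spinor := fun m x =>
    (2 * Real.pi * Complex.I) • freeWave τ m (w j) x - freeWave τ (pderiv j m) v x with hE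
  have hn2 : ‖(2 * Real.pi * Complex.I : ℂ)‖ = 2 * Real.pi := by
    simp [abs_of_pos hpi]
  have hEb : ∀ {m N}, SmoothSymbol R N m → L2Bound (E m) (8 * N * X) := fun {m N} hm => by
    have hN := hm.nonneg
    have h1 := (hm.bdd.l2Bound_freeWave hX (hp.grad_bound j) τ).const_smul (2 * Real.pi * Complex.I)
    have h2 := (hm.bdd_pderiv j).l2Bound_freeWave hX hp.bound τ
    rw [hn2] at h1
    refine (h1.sub h2 (by positivity) (by positivity)).mono ?_
    have : 0 ≤ N * X := by positivity
    nlinarith [Real.pi_lt_d2]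
  have cm := continuous_freeWave (τ := τ) hm.bdd hX hp.bound
  have cn := continuous_freeWave (τ := τ) hn.bdd hX hp.bound
  have b1 := (hEb hm).cross_left (L := L) cn.aestronglyMeasurable (hA n N' hn)
  have b2 := (hEb hn).cross_right (L := L) cm.aestronglyMeasurable (hA m N hm)
  have hAN : 0 ≤ A * N := (norm_nonneg _).trans (hA m N hm 0)
  have hAN' : 0 ≤ A * N' := (norm_nonneg _).trans (hA n N' hn 0)
  have b3 := (b1.add b2 (by positivity) (by positivity)).const_smul
    (-(2 * Real.pi * Complex.I * (τ : ℂ))⁻¹)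
  have hne : (2 * Real.pi * Complex.I * (τ : ℂ)) ≠ 0 := by
    simp [hτ, hpi.ne']
  have heq : ∀ x, commDensity L τ v (vel j) m n x =
      (-(2 * Real.pi * Complex.I * (τ : ℂ))⁻¹) •
        (cross L (E m) (freeWave τ n v) x + cross L (freeWave τ m v) (E n) x) := fun x => by
    -- The factor `2πi x_j` is purely imaginary, so its conjugate in the first entry cancels the
    -- contribution of the second.
    have e1 : cross L (fun _ => (2 * Real.pi * Complex.I * (x j : ℂ)) • freeWave τ m v x)
        (freeWave τ n v) x + cross L (freeWave τ m v)
        (fun _ => (2 * Real.pi * Complex.I * (x j : ℂ)) • freeWave τ n v x) x = 0 := by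
      simp only [cross, inner_smul_left, inner_smul_right, map_smul, map_mul, Complex.conj_I,
        Complex.conj_ofReal, map_ofNat]
      ring
    rw [coord_smul_freeWave hp hm τ j x, coord_smul_freeWave hp hn τ j x] at e1
    simp only [cross, inner_add_left, inner_add_right, inner_smul_left, inner_smul_right, map_smul,
      map_add] at e1
    rw [smul_eq_mul, commDensity]
    simp only [cross, hE]
    simp only [map_mul, Complex.conj_I, Complex.conj_ofReal, map_ofNat] at e1
    refine mul_left_cancel₀ hne ?_
    rw [neg_mul, mul_neg, mul_inv_cancel_left₀ hne]
    linear_combination e1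
  rw [show commDensity L τ v (vel j) m n = _ from funext heq]
  refine b3.mono ?_
  rw [norm_neg, norm_inv, norm_mul, hn2, Complex.norm_real, Real.norm_eq_abs, mul_inv]
  have hc : 0 ≤ ‖L‖ * X * (A * N) * N' := by positivity
  have e : ‖L‖ * (A * N') * (8 * N * X) + ‖L‖ * (A * N) * (8 * N' * X) =
      16 * (‖L‖ * X * (A * N) * N') := by ring
  rw [e, div_eq_mul_inv]
  -- The 16 comes from two errors, each bounded with constant `8 ≥ 2π + 1`.
  have h16 : (2 * Real.pi)⁻¹ * 16 ≤ 3 := by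
    rw [inv_mul_le_iff₀ (by positivity)]
    linarith [Real.pi_gt_three]
  calc _ = ((2 * Real.pi)⁻¹ * 16) * (‖L‖ * X * (A * N) * N') * |τ|⁻¹ := by ring
    _ ≤ 3 * (‖L‖ * X * (A * N) * N') * |τ|⁻¹ := by gcongr
    _ = _ := by ring

/-- The commutator with the square of the energy is a combination of commutators with the
velocities. -/
lemma commDensity_energy_sq (hp : Profile v w X) (hR : 1 ≤ R)
    (hm : SmoothSymbol R N m) (hn : SmoothSymbol R N' n) (L : Spinor →L[ℂ] Spinor) (x : Plane) :
    commDensity L τ v (fun η => energy η * energy η) m n x =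
      ∑ j : Fin 2,
        (commDensity L τ v (vel j) (fun η => energy η * (energy η * m η))
          (fun η => vel j η * (energy η * (energy η * n η))) x +
        commDensity L τ v (vel j) (fun η => vel j η * (energy η * (energy η * m η)))
          (fun η => energy η * (energy η * n η)) x) := by
  -- This is `E² |V|² + 1 = E²` at the level of waves. With energies `A`, `B` and velocities `V_A`,
  -- `V_B` in the two entries, the identity to be proved reads `A² - B² = A² B² (|V_A|² - |V_B|²)`,
  -- and each difference of squares `V_j²` telescopes into two commutators with `V_j`.
  have key : ∀ {n : Plane → ℝ} {N' : ℝ}, SmoothSymbol R N' n →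
      freeWave τ (fun η => vel 0 η * (vel 0 η * (energy η * (energy η * n η)))) v x +
      freeWave τ (fun η => vel 1 η * (vel 1 η * (energy η * (energy η * n η)))) v x +
        freeWave τ n v x = freeWave τ (fun η => energy η * (energy η * n η)) v x := by
    intro n N' hn
    have hee := (hn.energy_mul hR).energy_mul hR
    rw [← freeWave_add (((hee.vel_mul 0).vel_mul 0).bdd) (((hee.vel_mul 1).vel_mul 1).bdd)
      hp.nonneg hp.bound]
    have hsum : BddSymbol R (15 * (15 * (15 * R * (15 * R * N'))) +
        15 * (15 * (15 * R * (15 * R * N'))))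
        (fun η => vel 0 η * (vel 0 η * (energy η * (energy η * n η))) +
          vel 1 η * (vel 1 η * (energy η * (energy η * n η)))) :=
      ⟨((hee.vel_mul 0).vel_mul 0).bdd.cont.add ((hee.vel_mul 1).vel_mul 1).bdd.cont,
        fun η hη => by simp [hn.zero η hη], fun η => (abs_add_le _ _).trans
          (add_le_add (((hee.vel_mul 0).vel_mul 0).bound η) (((hee.vel_mul 1).vel_mul 1).bound η))⟩
    rw [← freeWave_add hsum hn.bdd hp.nonneg hp.bound]
    congr 1
    funext η
    have := sum_vel_sq η
    linear_combination n η * this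
  have k1 := key hm
  have k2 := key hn
  rw [Fin.sum_univ_two]
  simp only [commDensity, cross, mul_assoc]
  have a1 : L (freeWave τ (fun η => energy η * (energy η * n η)) v x) =
      L (freeWave τ (fun η => vel 0 η * (vel 0 η * (energy η * (energy η * n η)))) v x) +
      L (freeWave τ (fun η => vel 1 η * (vel 1 η * (energy η * (energy η * n η)))) v x) +
        L (freeWave τ n v x) := by rw [← k2, map_add, map_add]
  have a2 := congrArg
    (fun u => inner ℂ (freeWave τ (fun η => energy η * (energy η * m η)) v x) u) a1
  have a3 := congrArg
    (fun u => inner ℂ u (L (freeWave τ (fun η => energy η * (energy η * n η)) v x))) k1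
  simp only [inner_add_left, inner_add_right] at a2 a3
  linear_combination a2 + a3

end

section

variable {R N N' X A τ : ℝ} {m n : Plane → ℝ} {v : Plane → Spinor}
  {w : Fin 2 → Plane → Spinor}

lemma BddSymbol.exists_mul (hm : BddSymbol R N m) {a : Plane → ℝ} (ha : Continuous a) :
    ∃ N', BddSymbol R N' fun η => a η * m η := by
  have hz : ∀ η, R < ‖η‖ → a η * m η = 0 := fun η hη => by rw [hm.zero η hη, mul_zero]
  have hc : Continuous fun η => a η * m η := ha.mul hm.cont
  obtain ⟨C, hC⟩ := (hasCompactSupport_of_zero hz).exists_bound_of_continuous hc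
  exact ⟨C, hc, hz, hC⟩

lemma hasDerivAt_freeWave_exp (hm : BddSymbol R N m) (hX : 0 ≤ X) (hv : L2Bound v X) (x : Plane)
    (l : ℝ) :
    HasDerivAt (fun l => freeWave τ (fun η => Real.exp (-l * energy η) * m η) v x)
      (-freeWave τ (fun η => energy η * (Real.exp (-l * energy η) * m η)) v x) l := by
  have hE := continuous_energy
  have cexp : ∀ l : ℝ, Continuous fun η => Real.exp (-l * energy η) := fun l => by fun_prop
  have hF : ∀ l, Integrable (waveSym τ (fun η => Real.exp (-l * energy η) * m η) v) := fun l => by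
    obtain ⟨_, h⟩ := hm.exists_mul (cexp l)
    exact (h.intSq hX hv τ).int
  have hF' : ∀ l, Integrable
      (waveSym τ (fun η => energy η * (Real.exp (-l * energy η) * m η)) v) := fun l => by
    obtain ⟨_, h⟩ := hm.exists_mul (cexp l)
    obtain ⟨_, h'⟩ := h.exists_mul hE
    exact (h'.intSq hX hv τ).int
  simp only [freeWave, Real.fourierInv_eq', ← integral_neg]
  -- Over the unit ball around `l` the damping factor is largest at `l - 1`, which supplies the
  -- dominating function.
  refine (hasDerivAt_integral_of_dominated_loc_of_deriv_le
    (bound := fun η =>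
      ‖waveSym τ (fun η => energy η * (Real.exp (-(l - 1) * energy η) * m η)) v η‖)
    (F' := fun l η => -(Complex.exp (((2 * Real.pi * inner ℝ η x : ℝ) : ℂ) * Complex.I) •
      waveSym τ (fun η => energy η * (Real.exp (-l * energy η) * m η)) v η))
    (Metric.ball_mem_nhds l one_pos)
    (Filter.Eventually.of_forall fun l => (integrable_exp_smul (hF l) x).1)
    (integrable_exp_smul (hF l) x) (integrable_exp_smul (hF' l) x).1.neg
    (Filter.Eventually.of_forall fun η l' hl' => ?_) (hF' (l - 1)).norm
    (Filter.Eventually.of_forall fun η l' _ => ?_)).2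
  · rw [norm_neg, norm_smul, Complex.norm_exp_ofReal_mul_I, one_mul, norm_waveSym, norm_waveSym]
    refine mul_le_mul_of_nonneg_right ?_ (norm_nonneg _)
    rw [abs_mul, abs_mul, abs_mul, abs_mul, Real.abs_exp, Real.abs_exp]
    gcongr
    · exact (energy_pos η).le
    · rw [Metric.mem_ball, Real.dist_eq, abs_lt] at hl'
      linarith
  · have h1 : HasDerivAt (fun l : ℝ => Real.exp (-l * energy η) * m η)
        (Real.exp (-l' * energy η) * (-1 * energy η) * m η) l' :=
      (((hasDerivAt_id l').neg.mul_const (energy η)).exp).mul_const (m η)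
    have h2 := ((h1.ofReal_comp.const_mul (osc τ η)).smul_const (v η)).const_smul
      (Complex.exp (((2 * Real.pi * inner ℝ η x : ℝ) : ℂ) * Complex.I))
    refine h2.congr_deriv ?_
    simp only [waveSym]
    rw [← smul_neg, ← neg_smul]
    congr 2
    push_cast
    ring

lemma hasDerivAt_cross {L : Spinor →L[ℂ] Spinor} {f g : ℝ → Spinor} {f' g' : Spinor} {l : ℝ}
    (hf : HasDerivAt f f' l) (hg : HasDerivAt g g' l) :
    HasDerivAt (fun l => inner ℂ (f l) (L (g l))) (inner ℂ (f l) (L g') + inner ℂ f' (L (g l))) l := by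
  have h := (L.restrictScalars ℝ).hasFDerivAt.comp_hasDerivAt l hg
  exact hf.inner ℂ h

/-- Joint measurability in the damping parameter and the position, required for the Minkowski
inequality in `l2Bound_integral_Ioi`. -/
lemma stronglyMeasurable_freeWave_exp (hm : Continuous m) (hv : StronglyMeasurable v) :
    StronglyMeasurable fun p : ℝ × Plane =>
      freeWave τ (fun η => Real.exp (-p.1 * energy η) * m η) v p.2 := by
  have hE := continuous_energy
  have ho := continuous_osc τ
  have hc : Continuous fun q : (ℝ × Plane) × Plane =>
      Complex.exp (((2 * Real.pi * inner ℝ q.2 q.1.2 : ℝ) : ℂ) * Complex.I) *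
        (osc τ q.2 * ((Real.exp (-q.1.1 * energy q.2) * m q.2 : ℝ) : ℂ)) := by
    fun_prop
  have h := (hc.stronglyMeasurable.smul (hv.comp_measurable measurable_snd)).integral_prod_right'
    (ν := (volume : Measure Plane))
  simp only [freeWave, Real.fourierInv_eq', waveSym, smul_smul]
  exact h

/-- A crude bound without gain in `τ`, used for the convergence of the integral in the damping
parameter and for the limit at infinity. -/
lemma norm_commDensity_le (hA : SupBound τ R A v) (hA0 : 0 ≤ A) {a : Plane → ℝ} {M M' : ℝ}
    (hm : SmoothSymbol R N m) (hn : SmoothSymbol R N' n)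
    (ham : SmoothSymbol R M fun η => a η * m η) (han : SmoothSymbol R M' fun η => a η * n η)
    (L : Spinor →L[ℂ] Spinor) (x : Plane) :
    ‖commDensity L τ v a m n x‖ ≤ ‖L‖ * A ^ 2 * (N * M' + M * N') := by
  have h1 := (norm_cross_le L (freeWave τ m v) (freeWave τ (fun η => a η * n η) v) x)
  have h2 := (norm_cross_le L (freeWave τ (fun η => a η * m η) v) (freeWave τ n v) x)
  have e1 := mul_le_mul (hA m N hm x) (hA _ _ han x) (norm_nonneg _)
    (mul_nonneg hA0 hm.nonneg)
  have e2 := mul_le_mul (hA _ _ ham x) (hA n N' hn x) (norm_nonneg _)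
    (mul_nonneg hA0 ham.nonneg)
  calc _ ≤ ‖L‖ * ((A * N) * (A * M')) + ‖L‖ * ((A * M) * (A * N')) := by
        refine (norm_sub_le _ _).trans (add_le_add (h1.trans ?_) (h2.trans ?_)) <;> gcongr
    _ = _ := by ring

/-- The numerical constant in the bound for the commutator with the energy. -/
def laplaceConst : ℝ := 12 * 15 * 225 ^ 2 * 256

/-- The constant counts four velocity commutators with constant 3, a factor 15 for the extra
velocity, and `(15R)²` for the two energies on each of the two symbols. -/
lemma l2Bound_commDensity_energy_sq (hp : Profile v w X) (hA : SupBound τ R A v) (hA0 : 0 ≤ A)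
    (hτ : τ ≠ 0) (hR : 1 ≤ R) (hm : SmoothSymbol R N m) (hn : SmoothSymbol R N' n)
    (L : Spinor →L[ℂ] Spinor) :
    L2Bound (commDensity L τ v (fun η => energy η * energy η) m n)
      (12 * 15 * 225 ^ 2 * (‖L‖ * X * A * R ^ 4 * N * N' / |τ|)) := by
  have hem := (hm.energy_mul hR).energy_mul hR
  have hen := (hn.energy_mul hR).energy_mul hR
  have h1 := fun j => l2Bound_commDensity_vel hp hA hτ hem (hen.vel_mul j) L j
  have h2 := fun j => l2Bound_commDensity_vel hp hA hτ (hem.vel_mul j) hen L j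
  have hX := hp.nonneg
  have hN := hm.nonneg
  have hN' := hn.nonneg
  rw [show commDensity L τ v (fun η => energy η * energy η) m n = _ from
    funext fun x => commDensity_energy_sq hp hR hm hn L x]
  simp only [Fin.sum_univ_two]
  refine (((h1 0).add (h2 0) (by positivity) (by positivity)).add
    ((h1 1).add (h2 1) (by positivity) (by positivity)) (by positivity) (by positivity)).mono ?_
  refine le_of_eq ?_
  ring

/-- Division of `A² - B²` by `A + B`, the energies of the two entries, written as a Laplace
integral: damping both waves by `e^{-lE}` inserts `e^{-l(A+B)}`. Equivalently, the `l`-derivative of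
the damped commutator with `E` is minus the damped commutator with `E²`, and the former tends to 0.
-/
lemma commDensity_energy_eq_integral (hp : Profile v w X) (hA : SupBound τ R A v) (hA0 : 0 ≤ A)
    (hR : 1 ≤ R) (hm : SmoothSymbol R N m) (hn : SmoothSymbol R N' n)
    (L : Spinor →L[ℂ] Spinor) :
    StronglyMeasurable (Function.uncurry fun (l : ℝ) x =>
      commDensity L τ v (fun η => energy η * energy η)
        (fun η => Real.exp (-l * energy η) * m η) (fun η => Real.exp (-l * energy η) * n η) x) ∧
    ∀ x, commDensity L τ v energy m n x = ∫ l in Set.Ioi (0 : ℝ),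
      commDensity L τ v (fun η => energy η * energy η)
        (fun η => Real.exp (-l * energy η) * m η) (fun η => Real.exp (-l * energy η) * n η) x := by
  have hE := continuous_energy
  have cm := hm.smooth.continuous
  have cn := hn.smooth.continuous
  have comm2 : ∀ (l : ℝ) (m : Plane → ℝ), (fun η => energy η * energy η *
      (Real.exp (-l * energy η) * m η)) =
      fun η => Real.exp (-l * energy η) * (energy η * (energy η * m η)) := fun l m => by
    funext η; ring
  have comm1 : ∀ (l : ℝ) (m : Plane → ℝ), (fun η => energy η * (Real.exp (-l * energy η) * m η)) =
      fun η => Real.exp (-l * energy η) * (energy η * m η) := fun l m => by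
    funext η; ring
  have hmeas : StronglyMeasurable (Function.uncurry fun (l : ℝ) x =>
      commDensity L τ v (fun η => energy η * energy η)
        (fun η => Real.exp (-l * energy η) * m η)
        (fun η => Real.exp (-l * energy η) * n η) x) := by
    simp only [Function.uncurry_def, commDensity, cross, comm2]
    exact ((stronglyMeasurable_freeWave_exp cm hp.meas).inner (L.continuous.comp_stronglyMeasurable
      (stronglyMeasurable_freeWave_exp (hE.mul (hE.mul cn)) hp.meas))).sub
      ((stronglyMeasurable_freeWave_exp (hE.mul (hE.mul cm)) hp.meas).inner
        (L.continuous.comp_stronglyMeasurable (stronglyMeasurable_freeWave_exp cn hp.meas)))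
  refine ⟨hmeas, fun x => ?_⟩
  have hmE := hm.energy_mul hR
  have hnE := hn.energy_mul hR
  set P : ℝ → ℂ := fun l => commDensity L τ v energy (fun η => Real.exp (-l * energy η) * m η)
    (fun η => Real.exp (-l * energy η) * n η) x with hP
  set S : ℝ → ℂ := fun l => commDensity L τ v (fun η => energy η * energy η)
    (fun η => Real.exp (-l * energy η) * m η) (fun η => Real.exp (-l * energy η) * n η) x with hS
  have hderiv : ∀ l ∈ Set.Ici (0 : ℝ), HasDerivAt P (-S l) l := fun l _ => by
    have d1 := hasDerivAt_freeWave_exp (τ := τ) hm.bdd hp.nonneg hp.bound x l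
    have d2 := hasDerivAt_freeWave_exp (τ := τ) hnE.bdd hp.nonneg hp.bound x l
    have d3 := hasDerivAt_freeWave_exp (τ := τ) hmE.bdd hp.nonneg hp.bound x l
    have d4 := hasDerivAt_freeWave_exp (τ := τ) hn.bdd hp.nonneg hp.bound x l
    rw [comm1 l m] at d1
    rw [comm1 l (fun η => energy η * n η)] at d2
    rw [comm1 l (fun η => energy η * m η)] at d3
    rw [comm1 l n] at d4
    have d := (hasDerivAt_cross (L := L) d1 d2).sub (hasDerivAt_cross (L := L) d3 d4)
    simp only [hP, hS, commDensity, cross, comm1, comm2]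
    refine d.congr_deriv ?_
    -- The two mixed terms with one energy in each entry cancel, leaving only the terms with `E²`.
    simp only [inner_neg_left, inner_neg_right, map_neg]
    ring
  have hexp2 : ∀ l : ℝ, Real.exp (-l / 2) * Real.exp (-l / 2) = Real.exp (-l) := fun l => by
    rw [← Real.exp_add]; ring_nf
  have hbdS : ∀ l ∈ Set.Ioi (0 : ℝ), ‖-S l‖ ≤
      (‖L‖ * A ^ 2 * (2 * 256 * (225 * R ^ 2) * N * N')) * Real.exp (-l) := fun l hl => by
    have hl0 : 0 ≤ l := le_of_lt hl
    have a1 := hm.exp_mul hl0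
    have a2 := hn.exp_mul hl0
    have a3 := (hmE.energy_mul hR).exp_mul hl0
    have a4 := (hnE.energy_mul hR).exp_mul hl0
    rw [norm_neg]
    refine (norm_commDensity_le hA hA0 a1 a2 (by rw [comm2]; exact a3)
      (by rw [comm2]; exact a4) L x).trans (le_of_eq ?_)
    rw [← hexp2]
    ring
  have hint : IntegrableOn (fun l => -S l) (Set.Ioi 0) := by
    refine ((integrableOn_exp_neg_Ioi 0).const_mul
      (‖L‖ * A ^ 2 * (2 * 256 * (225 * R ^ 2) * N * N'))).mono' ?_
      ((ae_restrict_iff' measurableSet_Ioi).2 (Filter.Eventually.of_forall hbdS))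
    exact (hmeas.comp_measurable (g := fun l : ℝ => (l, x))
      (by fun_prop)).neg.aestronglyMeasurable
  have hlim : Filter.Tendsto P Filter.atTop (nhds 0) := by
    have hb : ∀ l : ℝ, 0 ≤ l → ‖P l‖ ≤
        (‖L‖ * A ^ 2 * (2 * 256 * (15 * R) * N * N')) * Real.exp (-l) := fun l hl0 => by
      have a1 := hm.exp_mul hl0
      have a2 := hn.exp_mul hl0
      have a3 := hmE.exp_mul hl0
      have a4 := hnE.exp_mul hl0
      refine (norm_commDensity_le hA hA0 a1 a2 (by rw [comm1]; exact a3)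
        (by rw [comm1]; exact a4) L x).trans (le_of_eq ?_)
      rw [← hexp2]
      ring
    refine squeeze_zero_norm' (Filter.eventually_atTop.2 ⟨0, hb⟩) ?_
    have := Real.tendsto_exp_neg_atTop_nhds_zero.const_mul
      (‖L‖ * A ^ 2 * (2 * 256 * (15 * R) * N * N'))
    rwa [mul_zero] at this
  have hfin := integral_Ioi_of_hasDerivAt_of_tendsto' hderiv hint hlim
  rw [integral_neg, zero_sub, neg_inj] at hfin
  rw [hfin]
  simp [hP]

lemma l2Bound_commDensity_energy (hp : Profile v w X) (hA : SupBound τ R A v) (hA0 : 0 ≤ A)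
    (hτ : τ ≠ 0) (hR : 1 ≤ R) (hm : SmoothSymbol R N m) (hn : SmoothSymbol R N' n)
    (L : Spinor →L[ℂ] Spinor) :
    L2Bound (commDensity L τ v energy m n)
      (laplaceConst * (‖L‖ * X * A * R ^ 4 * N * N' / |τ|)) := by
  obtain ⟨hmeas, heq⟩ := commDensity_energy_eq_integral (τ := τ) hp hA hA0 hR hm hn L
  have hX := hp.nonneg
  have hN := hm.nonneg
  have hN' := hn.nonneg
  rw [show commDensity L τ v energy m n = _ from funext heq]
  refine l2Bound_integral_Ioi (by unfold laplaceConst; positivity) hmeas fun l hl => ?_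
  refine (l2Bound_commDensity_energy_sq hp hA hA0 hτ hR (hm.exp_mul hl.le) (hn.exp_mul hl.le)
    L).mono (le_of_eq ?_)
  have hexp2 : Real.exp (-l / 2) * Real.exp (-l / 2) = Real.exp (-l) := by
    rw [← Real.exp_add]; ring_nf
  rw [← hexp2, laplaceConst]
  ring

end

/-! ### Gradients of densities of localised free waves. -/

lemma fourierInv_const_smul (c : ℂ) (G : Plane → Spinor) (x : Plane) :
    𝓕⁻ (fun η => c • G η) x = c • 𝓕⁻ G x := by
  simp only [Real.fourierInv_eq', smul_comm _ c, integral_smul]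

lemma fourier_const_smul_sub {f g : Plane → ℂ} (hf : Integrable f) (hg : Integrable g) (c : ℂ) :
    𝓕 (fun x => c * (f x - g x)) = fun ξ => c • (𝓕 f ξ - 𝓕 g ξ) := by
  funext ξ
  have h1 := (Real.fourierIntegral_convergent_iff ξ).2 hf
  have h2 := (Real.fourierIntegral_convergent_iff ξ).2 hg
  simp only [Real.fourier_eq]
  rw [← integral_sub h1 h2, ← integral_smul]
  refine integral_congr_ae (Filter.Eventually.of_forall fun x => ?_)
  simp only [← smul_sub]
  rw [smul_comm, smul_eq_mul c]

section

variable {R N N' X A τ : ℝ} {m n : Plane → ℝ} {v : Plane → Spinor}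
  {w : Fin 2 → Plane → Spinor}

lemma derivSym_waveSym (k : Fin 2) : derivSym k (waveSym τ m v) =
    fun η => (2 * Real.pi * Complex.I) • waveSym τ (fun η => η k * m η) v η := by
  funext η
  simp only [derivSym, waveSym, smul_smul]
  congr 1
  push_cast
  ring

lemma freeWave_const_mul (c : ℝ) (x : Plane) :
    freeWave τ (fun η => c * m η) v x = (c : ℂ) • freeWave τ m v x := by
  rw [freeWave, freeWave, ← fourierInv_const_smul]
  refine congrArg (fun G : Plane → Spinor => 𝓕⁻ G x) (funext fun η => ?_)
  simp only [waveSym, smul_smul]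
  congr 1
  push_cast
  ring

lemma intSq_derivSym_waveSym (hp : Profile v w X) (hR : 1 ≤ R) (hm : SmoothSymbol R N m)
    (k : Fin 2) : IntSq (derivSym k (waveSym τ m v)) := by
  have h := (hm.coord_mul hR k).bdd.intSq hp.nonneg hp.bound τ
  rw [derivSym_waveSym]
  exact ⟨h.int.smul (2 * Real.pi * Complex.I), h.sq.const_smul (2 * Real.pi * Complex.I)⟩

lemma crossDeriv_waveSym (L : Spinor →L[ℂ] Spinor) (k : Fin 2) (x : Plane) :
    crossDeriv L k (waveSym τ m v) (waveSym τ n v) x =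
      2 * Real.pi * Complex.I * commDensity L τ v (fun η => η k) m n x := by
  simp only [crossDeriv, commDensity, cross, derivSym_waveSym, fourierInv_const_smul, freeWave,
    inner_smul_left, inner_smul_right, map_smul, map_mul, Complex.conj_I, Complex.conj_ofReal,
    map_ofNat]
  ring

/-- Leibniz rule for commutators, applied to `2πη_k = E V_k`: the intermediate term, with `V_k` in
the first entry and `E` in the second, cancels. -/
lemma commDensity_coord (L : Spinor →L[ℂ] Spinor) (k : Fin 2) (x : Plane) :
    2 * Real.pi * commDensity L τ v (fun η => η k) m n x =
      commDensity L τ v (vel k) m (fun η => energy η * n η) x +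
        commDensity L τ v energy (fun η => vel k η * m η) n x := by
  have e1 : (fun η => vel k η * (energy η * n η)) = fun η => (2 * Real.pi) * (η k * n η) := by
    funext η; rw [← mul_assoc, mul_comm (vel k η), energy_mul_vel]; ring
  have e2 : (fun η => energy η * (vel k η * m η)) = fun η => (2 * Real.pi) * (η k * m η) := by
    funext η; rw [← mul_assoc, energy_mul_vel]; ring
  simp only [commDensity, cross, e1, e2, freeWave_const_mul, inner_smul_left, inner_smul_right,
    map_smul, Complex.conj_ofReal]
  push_cast
  ring

lemma l2Bound_crossDeriv (hp : Profile v w X) (hA : SupBound τ R A v) (hA0 : 0 ≤ A)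
    (hτ : τ ≠ 0) (hR : 1 ≤ R) (hm : SmoothSymbol R N m) (hn : SmoothSymbol R N' n)
    (L : Spinor →L[ℂ] Spinor) (k : Fin 2) :
    L2Bound (crossDeriv L k (waveSym τ m v) (waveSym τ n v))
      (16 * laplaceConst * (‖L‖ * X * A * R ^ 4 * N * N' / |τ|)) := by
  have hX := hp.nonneg
  have hN := hm.nonneg
  have hN' := hn.nonneg
  have h1 := l2Bound_commDensity_vel hp hA hτ hm (hn.energy_mul hR) L k
  have h2 := l2Bound_commDensity_energy hp hA hA0 hτ hR (hm.vel_mul k) hn L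
  have hl : 0 ≤ laplaceConst := by unfold laplaceConst; positivity
  have e : crossDeriv L k (waveSym τ m v) (waveSym τ n v) = fun x => Complex.I •
      (commDensity L τ v (vel k) m (fun η => energy η * n η) x +
        commDensity L τ v energy (fun η => vel k η * m η) n x) := by
    funext x
    rw [crossDeriv_waveSym, ← commDensity_coord, smul_eq_mul]
    ring
  rw [e]
  refine ((h1.add h2 (by positivity) (by positivity)).const_smul Complex.I).mono ?_
  rw [Complex.norm_I, one_mul]
  have hR4 : R ≤ R ^ 4 := by
    calc R = R ^ 1 := (pow_one R).symm
      _ ≤ R ^ 4 := pow_le_pow_right₀ hR (by norm_num)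
  have hc : 0 ≤ ‖L‖ * X * A * N * N' / |τ| := by positivity
  have hl45 : 45 ≤ laplaceConst := by unfold laplaceConst; norm_num
  calc _ = (‖L‖ * X * A * N * N' / |τ|) * (45 * R + 15 * (laplaceConst * R ^ 4)) := by ring
    _ ≤ (‖L‖ * X * A * N * N' / |τ|) * (laplaceConst * R ^ 4 + 15 * (laplaceConst * R ^ 4)) := by
        gcongr
    _ = _ := by ring

lemma l2Bound_derivSym_fourier_freeWave (hp : Profile v w X) (hA : SupBound τ R A v) (hA0 : 0 ≤ A)
    (hτ : τ ≠ 0) (hR : 1 ≤ R) (hm : SmoothSymbol R N m) (hn : SmoothSymbol R N' n)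
    (L : Spinor →L[ℂ] Spinor) (k : Fin 2) :
    L2Bound (derivSym k (𝓕 (cross L (freeWave τ m v) (freeWave τ n v))))
      (16 * laplaceConst * (‖L‖ * X * A * R ^ 4 * N * N' / |τ|)) :=
  l2Bound_derivSym_fourier_cross L (hm.bdd.intSq hp.nonneg hp.bound τ)
    (hn.bdd.intSq hp.nonneg hp.bound τ) (intSq_derivSym_waveSym hp hR hm)
    (intSq_derivSym_waveSym hp hR hn) (l2Bound_crossDeriv hp hA hA0 hτ hR hm hn L k)

/-- One derivative is spent as a commutator with `η_k`, giving a difference of two densities with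
symbols enlarged by `2R`; the gain `1/τ` comes from the other derivative. The constant is `2π · 4 ≤
28`. -/
lemma l2Bound_derivSym_derivSym_fourier_freeWave (hp : Profile v w X) (hA : SupBound τ R A v)
    (hA0 : 0 ≤ A) (hτ : τ ≠ 0) (hR : 1 ≤ R) (hm : SmoothSymbol R N m) (hn : SmoothSymbol R N' n)
    (L : Spinor →L[ℂ] Spinor) (j k : Fin 2) :
    L2Bound (derivSym j (derivSym k (𝓕 (cross L (freeWave τ m v) (freeWave τ n v)))))
      (28 * R * (16 * laplaceConst * (‖L‖ * X * A * R ^ 4 * N * N' / |τ|))) := by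
  have hX := hp.nonneg
  have hN := hm.nonneg
  have hN' := hn.nonneg
  have hl : 0 ≤ laplaceConst := by unfold laplaceConst; positivity
  have hpi := Real.pi_pos
  have i1 : Integrable (cross L (freeWave τ m v) (freeWave τ (fun η => η k * n η) v)) :=
    integrable_cross_fourierInv L (hm.bdd.intSq hp.nonneg hp.bound τ)
    ((hn.coord_mul hR k).bdd.intSq hp.nonneg hp.bound τ)
  have i2 : Integrable (cross L (freeWave τ (fun η => η k * m η) v) (freeWave τ n v)) :=
    integrable_cross_fourierInv L ((hm.coord_mul hR k).bdd.intSq hp.nonneg hp.bound τ)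
    (hn.bdd.intSq hp.nonneg hp.bound τ)
  have b1 := l2Bound_derivSym_fourier_freeWave hp hA hA0 hτ hR hm (hn.coord_mul hR k) L j
  have b2 := l2Bound_derivSym_fourier_freeWave hp hA hA0 hτ hR (hm.coord_mul hR k) hn L j
  have e : derivSym j (derivSym k (𝓕 (cross L (freeWave τ m v) (freeWave τ n v)))) =
      fun ξ => (2 * Real.pi * Complex.I : ℂ) •
      (derivSym j (𝓕 (cross L (freeWave τ m v) (freeWave τ (fun η => η k * n η) v))) ξ -
      derivSym j (𝓕 (cross L (freeWave τ (fun η => η k * m η) v) (freeWave τ n v))) ξ) := by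
    have e1 : crossDeriv L k (waveSym τ m v) (waveSym τ n v) = fun x => 2 * Real.pi * Complex.I *
        (cross L (freeWave τ m v) (freeWave τ (fun η => η k * n η) v) x -
          cross L (freeWave τ (fun η => η k * m η) v) (freeWave τ n v) x) :=
      funext fun x => crossDeriv_waveSym L k x
    have e2 := fourier_crossDeriv L (hm.bdd.intSq hp.nonneg hp.bound τ)
      (hn.bdd.intSq hp.nonneg hp.bound τ) (intSq_derivSym_waveSym hp hR hm)
      (intSq_derivSym_waveSym hp hR hn) k
    rw [e1, fourier_const_smul_sub i1 i2] at e2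
    change derivSym j (derivSym k (𝓕 (cross L (𝓕⁻ (waveSym τ m v)) (𝓕⁻ (waveSym τ n v))))) = _
    rw [← e2]
    funext ξ
    simp only [derivSym, smul_eq_mul]
    ring
  rw [e]
  refine ((b1.sub b2 (by positivity) (by positivity)).const_smul _).mono ?_
  have hn2 : ‖(2 * Real.pi * Complex.I : ℂ)‖ = 2 * Real.pi := by
    simp [abs_of_pos hpi]
  rw [hn2]
  have hc : 0 ≤ 16 * laplaceConst * (‖L‖ * X * A * R ^ 4 * N * N' / |τ|) := by positivity
  calc _ = (2 * Real.pi * 4) * (R * (16 * laplaceConst * (‖L‖ * X * A * R ^ 4 * N * N' / |τ|))) := by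
        ring
    _ ≤ 28 * (R * (16 * laplaceConst * (‖L‖ * X * A * R ^ 4 * N * N' / |τ|))) := by
        gcongr
        linarith [Real.pi_lt_d2]
    _ = _ := by ring

end

/-! ### Pointwise decay by self-improvement. -/

/-- The density with `L = id` is `|u|²`. The assumed sup bound `A` enters the right side only
linearly while the left side is quadratic in `u`, which is what allows the bound to improve itself.
-/
lemma exists_norm_freeWave_sq_le : ∃ C : ℝ, 0 < C ∧ ∀ (R X A τ N : ℝ) (m : Plane → ℝ)
    (v : Plane → Spinor) (w : Fin 2 → Plane → Spinor), Profile v w X → SupBound τ R A v → 0 ≤ A →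
    1 ≤ |τ| → 1 ≤ R → SmoothSymbol R N m → ∀ x, ‖freeWave τ m v x‖ ^ 2 ≤
      C * (X ^ 2 * (|τ|⁻¹) ^ 2 + X * A * R ^ 5 * |τ| ^ (-(15 / 16) : ℝ)) * N ^ 2 := by
  obtain ⟨C, hC, hmain⟩ := exists_norm_le_of_fourier_l2Bound
  refine ⟨C * (1 + 112 * (16 * laplaceConst)), by unfold laplaceConst; positivity,
    fun R X A τ N m v w hp hA hA0 hτ1 hR hm x => ?_⟩
  have hτ : τ ≠ 0 := by rintro rfl; norm_num at hτ1
  have hτ0 : 0 < |τ| := by linarith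
  have hX := hp.nonneg
  have hN := hm.nonneg
  have hl : 0 ≤ laplaceConst := by unfold laplaceConst; positivity
  set L := ContinuousLinearMap.id ℂ Spinor with hL
  have hLn : ‖L‖ ≤ 1 := ContinuousLinearMap.norm_id_le
  set g := cross L (freeWave τ m v) (freeWave τ m v) with hg
  set D := 16 * laplaceConst * (‖L‖ * X * A * R ^ 4 * N * N / |τ|) with hD
  have hD0 : 0 ≤ D := by positivity
  have hsq := hm.bdd.intSq hp.nonneg hp.bound τ
  have hgi : Integrable g := integrable_cross_fourierInv L hsq hsq
  have hgc : Continuous g :=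
    (differentiable_cross_fourierInv L hsq hsq (intSq_derivSym_waveSym hp hR hm)
      (intSq_derivSym_waveSym hp hR hm)).continuous
  have hgA : ∫ x, ‖g x‖ ≤ (N * X) ^ 2 := by
    have hu := hm.bdd.l2Bound_freeWave hX hp.bound τ
    refine (hu.integral_norm_cross_le hu (L := L) (by positivity) (by positivity)).2.trans ?_
    have : 0 ≤ N * X * (N * X) := by positivity
    nlinarith
  have b1 := l2Bound_derivSym_fourier_freeWave hp hA hA0 hτ hR hm hm L
  have b2 := l2Bound_derivSym_derivSym_fourier_freeWave hp hA hA0 hτ hR hm hm L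
  have hFc := continuous_fourier hgi
  have nb : ∀ {f : Plane → ℂ} {c : ℝ}, L2Bound f c → L2Bound (fun x => ‖f x‖) c :=
    fun {f c} h => by
      simpa using h.of_le_mul h.1.norm zero_le_one (Filter.Eventually.of_forall fun η => by simp)
  have h2pi : (1 : ℝ) ≤ 2 * Real.pi := by linarith [Real.pi_gt_three]
  have c1 : L2Bound (fun ξ => ‖ξ‖ * ‖𝓕 g ξ‖) (112 * R * D) := by
    have := ((nb (b1 0)).add (nb (b1 1)) hD0 hD0).of_le_mul
      (k := fun ξ => ‖ξ‖ * ‖𝓕 g ξ‖)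
      (continuous_norm.mul hFc.norm).aestronglyMeasurable zero_le_one
      (Filter.Eventually.of_forall fun ξ => by
        rw [norm_mul, norm_norm, norm_norm, one_mul]
        refine le_trans ?_ (Real.le_norm_self _)
        rw [norm_derivSym, norm_derivSym]
        calc ‖ξ‖ * ‖𝓕 g ξ‖ ≤ (1 * (|ξ 0| + |ξ 1|)) * ‖𝓕 g ξ‖ := by
              rw [one_mul]; gcongr; exact norm_le_sum_coord ξ
          _ ≤ (2 * Real.pi * (|ξ 0| + |ξ 1|)) * ‖𝓕 g ξ‖ := by gcongr
          _ = _ := by ring)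
    refine this.mono ?_
    nlinarith [mul_nonneg (by linarith : (0 : ℝ) ≤ R - 1) hD0]
  have c2 : L2Bound (fun ξ => ‖ξ‖ ^ 2 * ‖𝓕 g ξ‖) (112 * R * D) := by
    have hRD : 0 ≤ 28 * R * D := by positivity
    have := ((((nb (b2 0 0)).add (nb (b2 0 1)) hRD hRD).add
      ((nb (b2 1 0)).add (nb (b2 1 1)) hRD hRD) (by positivity) (by positivity))).of_le_mul
      (k := fun ξ => ‖ξ‖ ^ 2 * ‖𝓕 g ξ‖)
      ((continuous_norm.pow 2).mul hFc.norm).aestronglyMeasurable zero_le_one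
      (Filter.Eventually.of_forall fun ξ => by
        rw [norm_mul, norm_pow, norm_norm, norm_norm, one_mul]
        refine le_trans ?_ (Real.le_norm_self _)
        simp only [norm_derivSym]
        have h1 : ‖ξ‖ ≤ 2 * Real.pi * (|ξ 0| + |ξ 1|) := by
          have := norm_le_sum_coord ξ
          nlinarith [norm_nonneg ξ]
        calc ‖ξ‖ ^ 2 * ‖𝓕 g ξ‖ ≤ (2 * Real.pi * (|ξ 0| + |ξ 1|)) ^ 2 * ‖𝓕 g ξ‖ := by gcongr
          _ = _ := by ring)
    refine this.mono (le_of_eq ?_)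
    ring
  -- The threshold `r = 1/|τ|` makes the low-frequency part of size `τ⁻²` and costs only
  -- `|τ|^(1/16)` in the derivative part.
  have hfin := hmain g |τ|⁻¹ _ _ (inv_pos.2 hτ0) (by positivity) hgc hgi hgA c1 c2 x
  have hgx : ‖g x‖ = ‖freeWave τ m v x‖ ^ 2 := by
    simp only [hg, cross, hL, ContinuousLinearMap.id_apply]
    rw [inner_self_eq_norm_sq_to_K]
    simp
  rw [← hgx]
  refine hfin.trans ?_
  have hpow : (|τ|⁻¹) ^ (-(1 / 16) : ℝ) * |τ|⁻¹ = |τ| ^ (-(15 / 16) : ℝ) := by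
    rw [Real.inv_rpow hτ0.le, ← Real.rpow_neg hτ0.le, ← Real.rpow_neg_one, ← Real.rpow_add hτ0]
    norm_num
  have hDle : D ≤ 16 * laplaceConst * (X * A * R ^ 4 * N * N / |τ|) := by
    rw [hD]
    gcongr
    nlinarith
  set B := X * A * R ^ 5 * |τ| ^ (-(15 / 16) : ℝ) with hB
  have hB0 : 0 ≤ B := by positivity
  have hY : (|τ|⁻¹) ^ (-(1 / 16) : ℝ) * (112 * R * D) ≤ 112 * (16 * laplaceConst) * B * N ^ 2 := by
    calc _ ≤ (|τ|⁻¹) ^ (-(1 / 16) : ℝ) *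
          (112 * R * (16 * laplaceConst * (X * A * R ^ 4 * N * N / |τ|))) := by gcongr
      _ = 112 * (16 * laplaceConst) * (X * A * R ^ 5 *
          ((|τ|⁻¹) ^ (-(1 / 16) : ℝ) * |τ|⁻¹)) * N ^ 2 := by ring
      _ = _ := by rw [hpow]
  have hX2 : 0 ≤ X ^ 2 * (|τ|⁻¹) ^ 2 := by positivity
  calc _ ≤ C * ((|τ|⁻¹) ^ 2 * (N * X) ^ 2 + 112 * (16 * laplaceConst) * B * N ^ 2) := by gcongr
    _ = C * (1 * (X ^ 2 * (|τ|⁻¹) ^ 2) + 112 * (16 * laplaceConst) * B) * N ^ 2 := by ring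
    _ ≤ C * ((1 + 112 * (16 * laplaceConst)) * (X ^ 2 * (|τ|⁻¹) ^ 2) +
          (1 + 112 * (16 * laplaceConst)) * B) * N ^ 2 := by
        gcongr
        · linarith
        · linarith
    _ = _ := by ring

/-- **Pointwise decay** of free waves of frequency at most `R`. -/
lemma exists_supBound : ∃ C : ℝ, 0 < C ∧ ∀ (R X τ : ℝ) (v : Plane → Spinor)
    (w : Fin 2 → Plane → Spinor), Profile v w X → 1 ≤ |τ| → 1 ≤ R →
    SupBound τ R (C * X * R ^ 5 * |τ| ^ (-(15 / 16) : ℝ)) v := by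
  obtain ⟨C, hC, hmain⟩ := exists_norm_freeWave_sq_le
  refine ⟨C + 1, by positivity, fun R X τ v w hp hτ1 hR => ?_⟩
  have hτ0 : 0 < |τ| := by linarith
  have hX := hp.nonneg
  set q := |τ| ^ (-(15 / 16) : ℝ) with hq
  have hq0 : 0 ≤ q := by positivity
  have hqτ : |τ|⁻¹ ≤ q := by
    rw [← Real.rpow_neg_one, hq]
    exact Real.rpow_le_rpow_of_exponent_le hτ1 (by norm_num)
  -- The improvement is applied to the best constant `a = inf 𝒜`. It exists thanks to a crude finite
  -- bound, and it is itself admissible since the defining inequalities are closed in `A`.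
  set 𝒜 : Set ℝ := {A | 0 ≤ A ∧ SupBound τ R A v} with h𝒜
  have hne : 𝒜.Nonempty := by
    obtain ⟨c, hc, hcm⟩ := exists_integral_norm_waveSym_le R
    refine ⟨c * X, by positivity, fun m N hm x => ?_⟩
    refine (norm_fourierInv_le _ x).trans ((hcm N X τ m v hX hm.bdd hp.bound).2.trans (le_of_eq ?_))
    ring
  have hbdd : BddBelow 𝒜 := ⟨0, fun A hA => hA.1⟩
  set a := sInf 𝒜 with ha
  have ha0 : 0 ≤ a := le_csInf hne fun A hA => hA.1
  have haS : SupBound τ R a v := fun m N hm x => by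
    rcases hm.nonneg.eq_or_lt with h0 | hpos
    · obtain ⟨A, hA⟩ := hne
      have := hA.2 m N hm x
      rw [← h0, mul_zero] at this ⊢
      exact this
    · rw [← div_le_iff₀ hpos]
      refine le_csInf hne fun A hA => ?_
      rw [div_le_iff₀ hpos]
      exact hA.2 m N hm x
  set T := C * (X ^ 2 * (|τ|⁻¹) ^ 2 + X * a * R ^ 5 * q) with hT
  have hT0 : 0 ≤ T := by positivity
  have hmem : Real.sqrt T ∈ 𝒜 := ⟨Real.sqrt_nonneg _, fun m N hm x => by
    have h := hmain R X a τ N m v w hp haS ha0 hτ1 hR hm x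
    have hN := hm.nonneg
    refine abs_le_of_sq_le_sq' ?_ (by positivity) |>.2
    rw [mul_pow, Real.sq_sqrt hT0]
    exact h⟩
  have hle : a ≤ Real.sqrt T := csInf_le hbdd hmem
  have hsq : a ^ 2 ≤ T := by
    calc a ^ 2 ≤ Real.sqrt T ^ 2 := by gcongr
      _ = T := Real.sq_sqrt hT0
  set p := X * R ^ 5 * q with hp'
  have hp0 : 0 ≤ p := by positivity
  have hR5 : 1 ≤ R ^ 5 := one_le_pow₀ hR
  have hXp : X * |τ|⁻¹ ≤ p := by
    calc X * |τ|⁻¹ ≤ X * (1 * q) := by rw [one_mul]; gcongr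
      _ ≤ X * (R ^ 5 * q) := by gcongr
      _ = p := by ring
  have hsq2 : a ^ 2 ≤ C * p ^ 2 + C * p * a := by
    have h1 : (X * |τ|⁻¹) ^ 2 ≤ p ^ 2 := by gcongr
    calc a ^ 2 ≤ T := hsq
      _ = C * (X * |τ|⁻¹) ^ 2 + C * p * a := by rw [hT, hp']; ring
      _ ≤ _ := by gcongr
  have hfin : a ≤ (C + 1) * p := by
    by_contra hcon
    rw [not_le] at hcon
    have h1 : C * p ≤ a - p := by linarith
    have h2 : p ≤ a := by nlinarith
    nlinarith [mul_le_mul_of_nonneg_right h1 hp0, mul_le_mul_of_nonneg_right h1 ha0,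
      mul_nonneg hp0 ha0, mul_nonneg hC.le hp0]
  intro m N hm x
  refine (haS m N hm x).trans ?_
  have hN := hm.nonneg
  gcongr
  calc a ≤ (C + 1) * p := hfin
    _ = _ := by rw [hp']; ring

/-! ### Frequency cutoff and the decay of the full gradient. -/

/-- Smooth cutoffs to frequencies at most `R`. -/
lemma exists_cutoff : ∃ N : ℝ, 0 ≤ N ∧ ∀ R : ℝ, 1 ≤ R → ∃ χ : Plane → ℝ, SmoothSymbol R N χ ∧
    (∀ η, 0 ≤ χ η ∧ χ η ≤ 1) ∧ ∀ η, ‖η‖ ≤ R / 2 → χ η = 1 := by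
  let f : ContDiffBump (0 : Plane) := ⟨1 / 2, 1, by norm_num, by norm_num⟩
  have hfs : ContDiff ℝ ∞ (f : Plane → ℝ) := f.contDiff
  obtain ⟨A, hA⟩ := hfs.lipschitzWith_of_hasCompactSupport f.hasCompactSupport (by simp)
  refine ⟨1 + A, by positivity, fun R hR => ⟨fun η => f (R⁻¹ • η), ⟨?_, fun η hη => ?_,
    fun η => ?_, fun j η => ?_⟩, fun η => ⟨f.nonneg, f.le_one⟩, fun η hη => ?_⟩⟩
  · exact hfs.comp (contDiff_const_smul _)
  · refine f.zero_of_le_dist ?_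
    have : (1 : ℝ) ≤ R⁻¹ * ‖η‖ := by
      rw [inv_mul_eq_div, le_div_iff₀ (by linarith)]; linarith
    rw [dist_zero_right, norm_smul, Real.norm_of_nonneg (by positivity)]
    exact this
  · rw [abs_of_nonneg f.nonneg]
    exact f.le_one.trans (by simp)
  · have hlip : LipschitzWith A fun η : Plane => f (R⁻¹ • η) := by
      refine LipschitzWith.of_dist_le_mul fun x y => (hA.dist_le_mul _ _).trans ?_
      gcongr
      rw [dist_smul₀, Real.norm_of_nonneg (by positivity)]
      -- Since `R ≥ 1`, dilation does not increase the Lipschitz constant, so the symbol bound is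
      -- uniform in `R`.
      exact mul_le_of_le_one_left dist_nonneg (inv_le_one_of_one_le₀ hR)
    have h1 := norm_fderiv_le_of_lipschitz ℝ hlip (x₀ := η)
    have h2 := (fderiv ℝ (fun η : Plane => f (R⁻¹ • η)) η).le_opNorm (basisVec j)
    rw [norm_basisVec, mul_one] at h2
    exact (h2.trans h1).trans (by linarith)
  · refine f.one_of_mem_closedBall ?_
    rw [mem_closedBall_zero_iff, norm_smul, Real.norm_of_nonneg (by positivity), inv_mul_eq_div,
      div_le_iff₀ (by linarith)]
    change ‖η‖ ≤ 1 / 2 * R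
    linarith

lemma exists_l2Bound_energy_inv :
    ∃ c, 0 ≤ c ∧ L2Bound (fun η : Plane => (energy η ^ 2)⁻¹) c := by
  have hc : Continuous fun η : Plane => (energy η ^ 2)⁻¹ :=
    (continuous_energy.pow 2).inv₀ fun η => (pow_pos (energy_pos η) 2).ne'
  have h : MemLp (fun η : Plane => (energy η ^ 2)⁻¹) 2 volume := by
    rw [memLp_two_iff_integrable_sq hc.aestronglyMeasurable]
    have hd : Integrable fun η : Plane => (1 + ‖η‖) ^ (-(3 : ℝ)) :=
      integrable_one_add_norm (by simp; norm_num)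
    refine (hd.const_mul 8).mono' (hc.pow 2).aestronglyMeasurable
      (Filter.Eventually.of_forall fun η => ?_)
    have h0 : 0 ≤ ‖η‖ := norm_nonneg η
    have hE := energy_pos η
    have h1 : 1 + ‖η‖ ≤ 2 * energy η := by
      have : ‖η‖ ≤ energy η := by
        refine abs_le_of_sq_le_sq' ?_ hE.le |>.2
        rw [energy_sq]
        have h1 : 1 ≤ 2 * Real.pi := by linarith [Real.pi_gt_three]
        have h2 : ‖η‖ ≤ 2 * Real.pi * ‖η‖ := le_mul_of_one_le_left h0 h1
        nlinarith
      linarith [one_le_energy η]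
    rw [Real.norm_of_nonneg (by positivity), Real.rpow_neg (by positivity), ← inv_pow, ← pow_mul]
    have h3 : (1 + ‖η‖) ^ (3 : ℝ) = (1 + ‖η‖) ^ 3 := by
      rw [← Real.rpow_natCast]; norm_num
    rw [h3, inv_pow, ← div_eq_mul_inv, inv_eq_one_div, div_le_div_iff₀ (by positivity)
      (by positivity), one_mul]
    calc (1 + ‖η‖) ^ 3 ≤ (2 * energy η) ^ 3 := by gcongr
      _ = 8 * (energy η ^ 3 * 1) := by ring
      _ ≤ 8 * (energy η ^ 3 * energy η) := by gcongr; exact one_le_energy η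
      _ = _ := by ring
  exact ⟨(eLpNorm _ 2 volume).toReal, ENNReal.toReal_nonneg, h.1, (ENNReal.ofReal_toReal h.2.ne).ge⟩

/-- Free waves whose profile has `50` derivatives in `L²`: bounds that gain from the smallness `δ`
of the symbol relative to the weight `⟨η⟩^47`. -/
lemma exists_waveSym_bounds : ∃ c : ℝ, 0 ≤ c ∧ ∀ (X δ τ : ℝ) (m : Plane → ℝ) (v : Plane → Spinor),
    AEStronglyMeasurable v volume → 0 ≤ X → 0 ≤ δ → Continuous m →
    L2Bound (fun η => energy η ^ 50 * ‖v η‖) X → (∀ η, |m η| ≤ δ * energy η ^ 47) →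
    IntSq (waveSym τ m v) ∧ (∀ k, IntSq (derivSym k (waveSym τ m v))) ∧
    L2Bound (waveSym τ m v) (δ * X) ∧ (∀ k, L2Bound (derivSym k (waveSym τ m v)) (δ * X)) ∧
    ∫ η, ‖waveSym τ m v η‖ ≤ c * (δ * X) := by
  obtain ⟨c, hc, hw⟩ := exists_l2Bound_energy_inv
  refine ⟨c, hc, fun X δ τ m v hv hX hδ hm h50 hmb => ?_⟩
  have hmeas : ∀ {m : Plane → ℝ}, Continuous m → AEStronglyMeasurable (waveSym τ m v) volume :=
    fun {m} hm => by
      have := continuous_osc τ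
      exact (by fun_prop : Continuous fun η => osc τ η * (m η : ℂ)).aestronglyMeasurable.smul hv
  have hmeas' : ∀ k, AEStronglyMeasurable (derivSym k (waveSym τ m v)) volume := fun k => by
    rw [derivSym_waveSym]
    exact (hmeas ((contDiff_coord k).continuous.mul hm)).const_smul (2 * Real.pi * Complex.I)
  -- a common bound for both kinds of fields
  have key : ∀ {G : Plane → Spinor}, AEStronglyMeasurable G volume →
      (∀ η, ‖G η‖ ≤ δ * (energy η ^ 48 * ‖v η‖)) →
      IntSq G ∧ L2Bound G (δ * X) ∧ ∫ η, ‖G η‖ ≤ c * (δ * X) := fun {G} hG hb => by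
    have hL : L2Bound G (δ * X) := h50.of_le_mul hG hδ (Filter.Eventually.of_forall fun η => by
      have h1 := one_le_energy η
      rw [norm_mul, norm_norm, norm_pow, Real.norm_of_nonneg (energy_pos η).le]
      refine (hb η).trans ?_
      gcongr
      norm_num)
    obtain ⟨i1, i2⟩ := hw.integral_norm_mul_le h50 hc hX
    -- The count is `50 = 47 + 1 + 2`: 47 powers of the energy for smallness, one for a derivative,
    -- and two to pass from L² to L¹ by Cauchy–Schwarz.
    have hpt : ∀ η, ‖G η‖ ≤ δ * (‖(energy η ^ 2)⁻¹‖ * ‖energy η ^ 50 * ‖v η‖‖) := fun η => by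
      have h1 := energy_pos η
      refine (hb η).trans (le_of_eq ?_)
      rw [Real.norm_of_nonneg (by positivity), Real.norm_of_nonneg (by positivity)]
      field_simp
    have hi : Integrable G := (i1.const_mul δ).mono' hG (Filter.Eventually.of_forall hpt)
    refine ⟨⟨hi, hL.memLp⟩, hL, ?_⟩
    calc _ ≤ ∫ η, δ * (‖(energy η ^ 2)⁻¹‖ * ‖energy η ^ 50 * ‖v η‖‖) :=
          integral_mono hi.norm (i1.const_mul δ) hpt
      _ = δ * ∫ η, (‖(energy η ^ 2)⁻¹‖ * ‖energy η ^ 50 * ‖v η‖‖) := integral_const_mul _ _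
      _ ≤ δ * (c * X) := by gcongr
      _ = _ := by ring
  have hb : ∀ η, ‖waveSym τ m v η‖ ≤ δ * energy η ^ 47 * ‖v η‖ := fun η => by
    rw [norm_waveSym]
    exact mul_le_mul_of_nonneg_right (hmb η) (norm_nonneg _)
  have k0 := key (hmeas hm) fun η => by
    refine (hb η).trans ?_
    rw [mul_assoc]
    gcongr
    · exact one_le_energy η
    · norm_num
  have k1 := fun k => key (hmeas' k) fun η => by
    rw [norm_derivSym]
    have h1 : 2 * Real.pi * |η k| ≤ energy η := by
      have := abs_coord_le_bracket ((2 * Real.pi) • η) k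
      simpa [energy, abs_mul, abs_of_pos Real.pi_pos] using this
    calc _ ≤ energy η * (δ * energy η ^ 47 * ‖v η‖) := by
          have := energy_pos η
          gcongr
          exact hb η
      _ = _ := by ring
  exact ⟨k0.1, fun k => (k1 k).1, k0.2.1, fun k => (k1 k).2.1, k0.2.2⟩

/-- The full (unlocalised) free wave has a density with bounded gradient. -/
lemma exists_l2Bound_crossDeriv_of_regular : ∃ C : ℝ, 0 < C ∧
    ∀ (X τ : ℝ) (v : Plane → Spinor) (L : Spinor →L[ℂ] Spinor) (k : Fin 2),
    AEStronglyMeasurable v volume → 0 ≤ X → L2Bound (fun η => energy η ^ 50 * ‖v η‖) X →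
    L2Bound (crossDeriv L k (waveSym τ (fun _ => 1) v) (waveSym τ (fun _ => 1) v))
      (C * (‖L‖ * X ^ 2)) := by
  obtain ⟨c, hc, hmain⟩ := exists_waveSym_bounds
  refine ⟨2 * c + 1, by positivity, fun X τ v L k hv hX h50 => ?_⟩
  obtain ⟨i0, i1, b0, b1, bi⟩ := hmain X 1 τ (fun _ => 1) v hv hX zero_le_one continuous_const h50
    fun η => by
      rw [abs_one, one_mul]
      exact one_le_pow₀ (one_le_energy η)
  have hsup := fun x => (norm_fourierInv_le (waveSym τ (fun _ => 1) v) x).trans bi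
  have a1 := ((b1 k).fourierInv (i1 k).int).cross_right (L := L)
    (continuous_fourierInv i0.int).aestronglyMeasurable hsup
  have a2 := ((b1 k).fourierInv (i1 k).int).cross_left (L := L)
    (continuous_fourierInv i0.int).aestronglyMeasurable hsup
  refine (a1.add a2 (by positivity) (by positivity)).mono ?_
  have : 0 ≤ ‖L‖ * X ^ 2 := by positivity
  nlinarith

/-- Decay of the gradient of the density of a free wave with regular and localised profile. -/
lemma exists_l2Bound_crossDeriv_decay : ∃ C : ℝ, 0 < C ∧
    ∀ (X τ : ℝ) (v : Plane → Spinor) (w : Fin 2 → Plane → Spinor) (L : Spinor →L[ℂ] Spinor)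
    (k : Fin 2), Profile v w X → 1 ≤ |τ| → L2Bound (fun η => energy η ^ 50 * ‖v η‖) X →
    L2Bound (crossDeriv L k (waveSym τ (fun _ => 1) v) (waveSym τ (fun _ => 1) v))
      (C * (‖L‖ * X ^ 2) * |τ| ^ (-(7 / 4) : ℝ)) := by
  obtain ⟨c, hc, hbounds⟩ := exists_waveSym_bounds
  obtain ⟨N, hN, hcut⟩ := exists_cutoff
  obtain ⟨C, hC, hsupB⟩ := exists_supBound
  have hl : 0 ≤ laplaceConst := by unfold laplaceConst; positivity
  refine ⟨16 * laplaceConst * C * N ^ 2 + 2 * (C * N + 14 * C * N + c) + 1, by positivity,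
    fun X τ v w L k hp hτ1 h50 => ?_⟩
  have hX := hp.nonneg
  have hτ0 : 0 < |τ| := by linarith
  have hτ : τ ≠ 0 := abs_pos.1 hτ0
  -- The exponent is small enough that the loss `R⁹` of the low frequencies is affordable, and large
  -- enough that `R⁻⁴⁷` is small at high frequencies.
  set R : ℝ := |τ| ^ (1 / 50 : ℝ) with hR
  have hR1 : 1 ≤ R := Real.one_le_rpow hτ1 (by norm_num)
  have hR0 : 0 < R := by linarith
  obtain ⟨χ, hχ, hχ01, hχ1⟩ := hcut R hR1
  set A := C * X * R ^ 5 * |τ| ^ (-(15 / 16) : ℝ) with hA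
  have hA0 : 0 ≤ A := by positivity
  have hS : SupBound τ R A v := hsupB R X τ v w hp hτ1 hR1
  set δ := (R ^ 47)⁻¹ with hδ
  have hδ0 : 0 ≤ δ := by positivity
  -- low frequencies
  have il := hχ.bdd.intSq hX hp.bound τ
  have il' := intSq_derivSym_waveSym (τ := τ) hp hR1 hχ k
  have sl : ∀ x, ‖𝓕⁻ (waveSym τ χ v) x‖ ≤ A * N := hS χ N hχ
  have sl' : ∀ x, ‖𝓕⁻ (derivSym k (waveSym τ χ v)) x‖ ≤ 14 * R * (A * N) := fun x => by
    rw [derivSym_waveSym, fourierInv_const_smul, norm_smul]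
    have hn2 : ‖(2 * Real.pi * Complex.I : ℂ)‖ = 2 * Real.pi := by
      simp [abs_of_pos Real.pi_pos]
    have h1 := hS _ _ (hχ.coord_mul hR1 k) x
    have hpi : 2 * Real.pi ≤ 7 := by linarith [Real.pi_lt_d2]
    rw [hn2]
    calc _ ≤ 7 * (A * (2 * R * N)) := by
          gcongr
          exact h1
      _ = _ := by ring
  have bll := l2Bound_crossDeriv hp hS hA0 hτ hR1 hχ hχ L k
  -- high frequencies
  obtain ⟨ih, ih', bh, bh', sh⟩ := hbounds X δ τ (fun η => 1 - χ η) v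
    hp.bound.1 hX hδ0 (continuous_const.sub hχ.smooth.continuous) h50 fun η => by
      rw [abs_of_nonneg (by linarith [(hχ01 η).2])]
      by_cases hη : ‖η‖ ≤ R / 2
      · rw [hχ1 η hη]
        have := energy_pos η
        simp only [sub_self]
        positivity
      · have h1 : R ≤ energy η := by
          refine abs_le_of_sq_le_sq' ?_ (energy_pos η).le |>.2
          rw [energy_sq]
          have h2 : R ≤ 2 * Real.pi * ‖η‖ := by
            have := Real.pi_gt_three
            rw [not_le] at hη
            nlinarith
          nlinarith
        calc 1 - χ η ≤ 1 := by linarith [(hχ01 η).1]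
          _ = (R ^ 47)⁻¹ * R ^ 47 := (inv_mul_cancel₀ (by positivity)).symm
          _ ≤ δ * energy η ^ 47 := by gcongr
  have sh0 := fun x => (norm_fourierInv_le (waveSym τ (fun η => 1 - χ η) v) x).trans sh
  have cl := (continuous_fourierInv il.int).aestronglyMeasurable (μ := (volume : Measure Plane))
  have cl' := (continuous_fourierInv il'.int).aestronglyMeasurable (μ := (volume : Measure Plane))
  have ch := (continuous_fourierInv ih.int).aestronglyMeasurable (μ := (volume : Measure Plane))
  have b2 := bh.fourierInv ih.int
  have b2' := (bh' k).fourierInv (ih' k).int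
  -- In each of the six terms with a high-frequency factor, one such factor is placed in L² and the
  -- other wave in L^∞: by pointwise decay if it is low, by integrability of its transform if it is
  -- high.
  have t1 := b2'.cross_right (L := L) cl sl
  have t2 := b2.cross_left (L := L) cl' sl'
  have t3 := b2'.cross_right (L := L) ch sh0
  have t4 := b2.cross_right (L := L) cl' sl'
  have t5 := b2'.cross_left (L := L) cl sl
  have t6 := b2'.cross_left (L := L) ch sh0
  have p1 : 0 ≤ A * N := by positivity
  have p2 : 0 ≤ δ * X := by positivity
  have hsum := bll.add (((t1.add t2 (by positivity) (by positivity)).add t3 (by positivity)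
    (by positivity)).add ((t4.add t5 (by positivity) (by positivity)).add t6 (by positivity)
    (by positivity)) (by positivity) (by positivity)) (by positivity) (by positivity)
  have hadd : ∀ {F G : Plane → Spinor}, Integrable F → Integrable G → ∀ x,
      𝓕⁻ (fun η => F η + G η) x = 𝓕⁻ F x + 𝓕⁻ G x := fun {F G} hF hG x => by
    simp only [Real.fourierInv_eq']
    rw [← integral_add (integrable_exp_smul hF x) (integrable_exp_smul hG x)]
    simp only [smul_add]
  have hsplit : waveSym τ (fun _ => 1) v =
      fun η => waveSym τ χ v η + waveSym τ (fun η => 1 - χ η) v η := by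
    funext η
    simp only [waveSym, ← add_smul]
    congr 1
    push_cast
    ring
  have hsplit' : derivSym k (waveSym τ (fun _ => 1) v) = fun η =>
      derivSym k (waveSym τ χ v) η + derivSym k (waveSym τ (fun η => 1 - χ η) v) η := by
    rw [hsplit]
    funext η
    simp only [derivSym, smul_add]
  have heq : crossDeriv L k (waveSym τ (fun _ => 1) v) (waveSym τ (fun _ => 1) v) = fun x =>
      crossDeriv L k (waveSym τ χ v) (waveSym τ χ v) x +
      ((cross L (𝓕⁻ (waveSym τ χ v)) (𝓕⁻ (derivSym k (waveSym τ (fun η => 1 - χ η) v))) x +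
        cross L (𝓕⁻ (waveSym τ (fun η => 1 - χ η) v)) (𝓕⁻ (derivSym k (waveSym τ χ v))) x +
        cross L (𝓕⁻ (waveSym τ (fun η => 1 - χ η) v))
          (𝓕⁻ (derivSym k (waveSym τ (fun η => 1 - χ η) v))) x) +
      (cross L (𝓕⁻ (derivSym k (waveSym τ χ v))) (𝓕⁻ (waveSym τ (fun η => 1 - χ η) v)) x +
        cross L (𝓕⁻ (derivSym k (waveSym τ (fun η => 1 - χ η) v))) (𝓕⁻ (waveSym τ χ v)) x +
        cross L (𝓕⁻ (derivSym k (waveSym τ (fun η => 1 - χ η) v)))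
          (𝓕⁻ (waveSym τ (fun η => 1 - χ η) v)) x)) := by
    funext x
    rw [crossDeriv, hsplit', hsplit]
    simp only [crossDeriv, cross, hadd il.int ih.int, hadd il'.int (ih' k).int, inner_add_left,
      inner_add_right, map_add]
    ring
  rw [heq]
  refine hsum.mono ?_
  set q := |τ| ^ (-(7 / 4) : ℝ) with hq
  have hRpow : ∀ n : ℕ, R ^ n = |τ| ^ ((n : ℝ) / 50) := fun n => by
    rw [hR, ← Real.rpow_natCast, ← Real.rpow_mul hτ0.le]
    congr 1
    ring
  have hq0 : 0 ≤ q := by positivity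
  -- The exponents are `9/50 - 15/16 - 1` for low-low terms, at most `6/50 - 15/16 - 47/50` for
  -- low-high terms, and `-94/50` for high-high terms. The first two equal `-703/400`, just below
  -- `-7/4`.
  have q1 : R ^ 9 * |τ| ^ (-(15 / 16) : ℝ) / |τ| ≤ q := by
    rw [div_eq_mul_inv, ← Real.rpow_neg_one |τ|, hRpow, ← Real.rpow_add hτ0, ← Real.rpow_add hτ0]
    exact Real.rpow_le_rpow_of_exponent_le hτ1 (by norm_num)
  have q2 : R ^ 6 * |τ| ^ (-(15 / 16) : ℝ) * δ ≤ q := by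
    rw [hδ, hRpow, hRpow, ← Real.rpow_neg hτ0.le, ← Real.rpow_add hτ0, ← Real.rpow_add hτ0]
    exact Real.rpow_le_rpow_of_exponent_le hτ1 (by norm_num)
  have q3 : δ * δ ≤ q := by
    rw [hδ, hRpow, ← Real.rpow_neg hτ0.le, ← Real.rpow_add hτ0]
    exact Real.rpow_le_rpow_of_exponent_le hτ1 (by norm_num)
  have q2' : R ^ 5 * |τ| ^ (-(15 / 16) : ℝ) * δ ≤ q := by
    refine le_trans ?_ q2
    gcongr
    norm_num
  set Z := ‖L‖ * X ^ 2 with hZ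
  have hZ0 : 0 ≤ Z := by positivity
  calc _ = 16 * laplaceConst * C * N ^ 2 * Z * (R ^ 9 * |τ| ^ (-(15 / 16) : ℝ) / |τ|) +
        2 * (C * N * Z * (R ^ 5 * |τ| ^ (-(15 / 16) : ℝ) * δ) +
          14 * C * N * Z * (R ^ 6 * |τ| ^ (-(15 / 16) : ℝ) * δ) + c * Z * (δ * δ)) := by
        rw [hA, hZ]; ring
    _ ≤ 16 * laplaceConst * C * N ^ 2 * Z * q +
        2 * (C * N * Z * q + 14 * C * N * Z * q + c * Z * q) := by gcongr
    _ ≤ 16 * laplaceConst * C * N ^ 2 * Z * q +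
        2 * (C * N * Z * q + 14 * C * N * Z * q + c * Z * q) + Z * q := by
        have : 0 ≤ Z * q := by positivity
        linarith
    _ = _ := by ring

/-! ### From the norm of `Σ_T` to profiles, and conclusion. -/

lemma l2Bound_Lp_fourier {F : Type*} [NormedAddCommGroup F] [InnerProductSpace ℂ F]
    [CompleteSpace F] {f : Lp (α := Plane) F 2 volume} {c : ℝ} (h : L2Bound f c) :
    L2Bound (𝓕 f : Lp (α := Plane) F 2 volume) c :=
  ⟨(Lp.memLp _).1, by rw [eLpNorm_Lp_fourier]; exact h.2⟩

/-- A weighted field with the components `x_j f` in `L²` provides a weak gradient of `𝓕 f`. -/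
lemma profile_fourier {f : L2Spinor} {X : ℝ} (hX : 0 ≤ X) (hf : L2Bound f X)
    (hx : ∀ j : Fin 2, L2Bound (fun x : Plane => ((x j : ℝ) : ℂ) • f x) X) :
    Profile (𝓕 f : L2Spinor)
      (fun j => (𝓕 ((hx j).memLp.toLp fun x : Plane => ((x j : ℝ) : ℂ) • f x) : L2Spinor)) X where
  nonneg := hX
  meas := Lp.stronglyMeasurable _
  bound := l2Bound_Lp_fourier hf
  grad_bound j := l2Bound_Lp_fourier ((hx j).congr_ae (hx j).memLp.coeFn_toLp.symm)
  weak_grad Φ hΦ hc j := by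
    have hd : ∀ k, ContDiff ℝ ∞ fun η => fderiv ℝ Φ η (basisVec k) := fun k =>
      (hΦ.fderiv_right (m := ∞) (by simp)).clm_apply contDiff_const
    have hdc : ∀ k, HasCompactSupport fun η => fderiv ℝ Φ η (basisVec k) := fun k =>
      hc.fderiv_apply ℝ (basisVec k)
    have h1 := integral_schwartz_smul_fourier ((hdc j).toSchwartzMap (hd j)) f
    have h2 := integral_schwartz_smul_fourier (hc.toSchwartzMap hΦ)
      ((hx j).memLp.toLp fun x : Plane => ((x j : ℝ) : ℂ) • f x)
    have e1 : ((hdc j).toSchwartzMap (hd j) : Plane → ℂ) =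
      fun η => fderiv ℝ Φ η (basisVec j) := rfl
    have e2 : (hc.toSchwartzMap hΦ : Plane → ℂ) = Φ := rfl
    simp only [e1] at h1
    simp only [e2] at h2
    rw [h1, h2, ← integral_smul]
    refine integral_congr_ae ?_
    filter_upwards [(hx j).memLp.coeFn_toLp] with x hx'
    rw [hx', fourier_partialDeriv (hΦ.continuous.integrable_of_hasCompactSupport hc)
      (hΦ.differentiable (by simp))
      fun k => (hd k).continuous.integrable_of_hasCompactSupport (hdc k)]
    simp only [derivSym, smul_smul, smul_eq_mul]
    congr 1
    ring

lemma l2Bound_of_sobolevNorm {E : Type*} [NormedAddCommGroup E] [InnerProductSpace ℂ E]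
    [CompleteSpace E] {s M : ℝ} (hs : 0 ≤ s) {u : Plane → E}
    (h : sobolevNorm s u ≤ ENNReal.ofReal M) : L2Bound u M := by
  have hu : MemLp u 2 volume := by
    by_contra hu
    rw [sobolevNorm, dif_neg hu] at h
    simp at h
  rw [sobolevNorm, dif_pos hu] at h
  refine ⟨hu.1, ?_⟩
  rw [← eLpNorm_congr_ae hu.coeFn_toLp, ← eLpNorm_Lp_fourier]
  refine (eLpNorm_mono fun η => ?_).trans h
  rw [norm_smul, Complex.norm_real]
  refine le_mul_of_one_le_left (norm_nonneg _) ?_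
  exact (Real.one_le_rpow (one_le_bracket _) hs).trans (Real.le_norm_self _)

lemma l2Bound_energy_pow_of_sobolevNorm {s M : ℝ} {n : ℕ} (hs : n ≤ s) {u : L2Spinor}
    (h : sobolevNorm s u ≤ ENNReal.ofReal M) :
    L2Bound (fun η => energy η ^ n * ‖(𝓕 u : L2Spinor) η‖) M := by
  rw [sobolevNorm, dif_pos (Lp.memLp u), Lp.toLp_coeFn] at h
  refine ⟨(continuous_energy.pow n).aestronglyMeasurable.mul (Lp.memLp _).1.norm,
    (eLpNorm_mono fun η => ?_).trans h⟩
  have hE := energy_pos η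
  rw [norm_smul, Complex.norm_real, norm_mul, norm_norm, Real.norm_of_nonneg (by positivity)]
  gcongr
  rw [← Real.rpow_natCast]
  exact (Real.rpow_le_rpow_of_exponent_le (one_le_energy η) hs).trans (Real.le_norm_self _)

/-- Undoing the evolution operator presents `φ` as a free wave at time `τ = θt`, whose profile is
the transform of the field that carries the weight `x` in the norm of `Σ_T`. -/
lemma fourier_wave_ae_eq (θ : ℤˣ) (t : ℝ) (φ : L2Spinor) :
    (𝓕 φ : L2Spinor) =ᵐ[volume]
      waveSym (sgn θ * t) (fun _ => 1) (𝓕 (wave θ t φ) : L2Spinor) := by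
  have h : (𝓕 (wave θ t φ) : L2Spinor) = (memLp_symbol_apply (waveSymbol θ t)
      (continuous_waveSymbol θ t) (bounded_waveSymbol θ t) (𝓕 φ)).toLp
      (fun η : Plane => waveSymbol θ t ((2 * Real.pi) • η) ((𝓕 φ : L2Spinor) η)) :=
    FourierTransform.fourier_fourierInv_eq _
  rw [h]
  filter_upwards [(memLp_symbol_apply (waveSymbol θ t)
      (continuous_waveSymbol θ t) (bounded_waveSymbol θ t) (𝓕 φ)).coeFn_toLp] with η hη
  rw [waveSym, hη, waveSymbol]
  simp only [smul_apply, ContinuousLinearMap.id_apply, smul_smul]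
  rw [osc, energy, Complex.ofReal_one, mul_one, ← Complex.exp_add, ← add_mul]
  simp

lemma sobolevNorm_add_le_sigmaNorm (s T : ℝ) (ψ : ℝ → L2Spinor) (θ : ℤˣ) {t : ℝ}
    (ht : t ∈ Set.Icc 0 T) :
    sobolevNorm s (proj θ (ψ t)) + sobolevNorm 5 (posMul (wave θ t (proj θ (ψ t)))) ≤
      sigmaNorm s T ψ := by
  have h : sobolevNorm s (proj θ (ψ t)) + sobolevNorm 5 (posMul (wave θ t (proj θ (ψ t)))) ≤
      sigmaNormSign s T θ fun t => proj θ (ψ t) :=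
    le_iSup₂ (f := fun t _ => sobolevNorm s (proj θ (ψ t)) +
      sobolevNorm 5 (posMul (wave θ t (proj θ (ψ t))))) t ht
  refine h.trans ?_
  rcases Int.units_eq_one_or θ with rfl | rfl
  · exact le_self_add
  · exact le_add_self

/-- The decay rate of the gradient of the density, for all times. -/
lemma exists_l2Bound_derivSym_density (γ : ℝ) (hγ : 0 ≤ γ) : ∃ C : ℝ, 0 < C ∧
    ∀ (s : ℝ), 50 ≤ s → ∀ (M : ℝ), 0 ≤ M → ∀ (θ : ℤˣ) (t : ℝ), 0 ≤ t → ∀ φ : L2Spinor,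
      sobolevNorm s φ ≤ ENNReal.ofReal M →
      sobolevNorm 5 (posMul (wave θ t φ)) ≤ ENNReal.ofReal M → ∀ μ : Fin 3,
      Integrable (density μ φ) ∧ ∀ k, L2Bound (derivSym k (𝓕 (density μ φ)))
        (C * bracket t ^ (-(7 / 4 : ℝ) + γ) * M ^ 2) := by
  obtain ⟨c₁, hc₁, hreg⟩ := exists_l2Bound_crossDeriv_of_regular
  obtain ⟨c₂, hc₂, hdec⟩ := exists_l2Bound_crossDeriv_decay
  obtain ⟨c₃, -, hbd⟩ := exists_waveSym_bounds
  refine ⟨4 * (c₁ + c₂) * ∑ μ, ‖alphaOp μ‖ + 1, by positivity,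
    fun s hs M hM θ t ht φ h1 h2 μ => ?_⟩
  set v : L2Spinor := 𝓕 (wave θ t φ) with hv
  set τ := sgn θ * t with hτ
  have hτt : |τ| = t := by rw [hτ, abs_mul, abs_sgn, one_mul, abs_of_nonneg ht]
  have hae : (𝓕 φ : L2Spinor) =ᵐ[volume] waveSym τ (fun _ => 1) v := fourier_wave_ae_eq θ t φ
  -- The oscillating factor has modulus 1, so the profile inherits the Sobolev regularity of `φ`.
  have h50 : L2Bound (fun η => energy η ^ 50 * ‖v η‖) M :=
    (l2Bound_energy_pow_of_sobolevNorm (n := 50) (by exact_mod_cast hs) h1).congr_ae (by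
      filter_upwards [hae] with η hη
      rw [hη, norm_waveSym, abs_one, one_mul])
  have hvm : AEStronglyMeasurable v volume := (Lp.memLp v).1
  have hvM : L2Bound v M := by
    have := h50.of_le_mul hvm zero_le_one (Filter.Eventually.of_forall fun η => by
      rw [one_mul, norm_mul, norm_norm, Real.norm_of_nonneg (pow_nonneg (energy_pos η).le _)]
      exact le_mul_of_one_le_left (norm_nonneg _) (one_le_pow₀ (one_le_energy η)))
    rwa [one_mul] at this
  have hfM : L2Bound (wave θ t φ) M :=
    ⟨(Lp.memLp _).1, by rw [← eLpNorm_Lp_fourier]; exact hvM.2⟩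
  have hx : ∀ j : Fin 2, L2Bound (fun x : Plane => ((x j : ℝ) : ℂ) • wave θ t φ x) M := fun j => by
    have hmeas : AEStronglyMeasurable (fun x : Plane => ((x j : ℝ) : ℂ) • wave θ t φ x) volume :=
      (Complex.continuous_ofReal.comp (contDiff_coord j).continuous).aestronglyMeasurable.smul
        (Lp.memLp (wave θ t φ)).1
    have := (l2Bound_of_sobolevNorm (by norm_num) h2).of_le_mul hmeas zero_le_one
      (Filter.Eventually.of_forall fun x => by
        rw [one_mul]
        exact PiLp.norm_apply_le (posMul (wave θ t φ) x) j)
    rwa [one_mul] at this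
  have hp := profile_fourier hM hfM hx
  obtain ⟨i0, i1, -⟩ := hbd M 1 τ (fun _ => 1) v hvm hM zero_le_one continuous_const h50
    fun η => by
      rw [abs_one, one_mul]
      exact one_le_pow₀ (one_le_energy η)
  have hφ : φ =ᵐ[volume] 𝓕⁻ (waveSym τ (fun _ => 1) v) := by
    refine (ae_eq_fourierInv φ (i0.int.congr hae.symm)).trans (Filter.Eventually.of_forall ?_)
    exact Real.fourierInv_congr_ae hae
  have hden : density μ φ =ᵐ[volume] cross (alphaOp μ)
      (𝓕⁻ (waveSym τ (fun _ => 1) v)) (𝓕⁻ (waveSym τ (fun _ => 1) v)) := by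
    filter_upwards [hφ] with x hx'
    rw [density, cross, hx']
  refine ⟨(integrable_cross_fourierInv _ i0 i0).congr hden.symm, fun k => ?_⟩
  rw [show 𝓕 (density μ φ) = _ from funext (Real.fourier_congr_ae hden)]
  refine l2Bound_derivSym_fourier_cross (alphaOp μ) i0 i0 i1 i1 ?_
  have hb : bracket t ^ 2 = 1 + t ^ 2 := by
    rw [bracket, Real.sq_sqrt (by positivity), Real.norm_of_nonneg ht]
  have hb0 : 0 ≤ bracket t := Real.sqrt_nonneg _
  have hb1 : 1 ≤ bracket t := by nlinarith [sq_nonneg t]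
  have hbγ : bracket t ^ (-(7 / 4) : ℝ) ≤ bracket t ^ (-(7 / 4 : ℝ) + γ) :=
    Real.rpow_le_rpow_of_exponent_le hb1 (by linarith)
  have hα : ‖alphaOp μ‖ ≤ ∑ μ, ‖alphaOp μ‖ :=
    Finset.single_le_sum (f := fun μ => ‖alphaOp μ‖) (fun _ _ => norm_nonneg _) (Finset.mem_univ μ)
  -- The factor 4 pays for `⟨t⟩ ≤ 2t` when `t ≥ 1` and for `⟨t⟩ ≤ 2` when `t ≤ 1`.
  have h4 : (1 : ℝ) ≤ 4 * 2 ^ (-(7 / 4) : ℝ) := by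
    have : (2 : ℝ) ^ (-2 : ℝ) ≤ 2 ^ (-(7 / 4) : ℝ) :=
      Real.rpow_le_rpow_of_exponent_le (by norm_num) (by norm_num)
    have e : (2 : ℝ) ^ (-2 : ℝ) = 1 / 4 := by
      rw [Real.rpow_neg (by norm_num)]; norm_num
    linarith
  set B := bracket t ^ (-(7 / 4 : ℝ) + γ) with hB
  have hB0 : 0 ≤ B := by positivity
  set S := ∑ μ, ‖alphaOp μ‖ with hS
  have hSM : ‖alphaOp μ‖ * M ^ 2 ≤ S * M ^ 2 := by gcongr
  have hSM0 : 0 ≤ ‖alphaOp μ‖ * M ^ 2 := by positivity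
  have fin : ∀ c r : ℝ, 0 ≤ c → c ≤ c₁ + c₂ → 0 ≤ r → r ≤ 4 * B →
      c * (‖alphaOp μ‖ * M ^ 2) * r ≤ (4 * (c₁ + c₂) * S + 1) * B * M ^ 2 := by
    intro c r hc hc' hr hrB
    calc c * (‖alphaOp μ‖ * M ^ 2) * r ≤ (c₁ + c₂) * (S * M ^ 2) * (4 * B) := by gcongr
      _ ≤ (c₁ + c₂) * (S * M ^ 2) * (4 * B) + B * M ^ 2 := le_add_of_nonneg_right (by positivity)
      _ = _ := by ring
  -- Large times use the decay estimate, small times the uniform bound for regular profiles.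
  rcases le_total 1 t with h | h
  · refine (hdec M τ v _ (alphaOp μ) k hp (by rwa [hτt]) h50).mono (fin _ _ hc₂.le (by linarith)
      (by positivity) ?_)
    have hbt : bracket t ≤ 2 * t := by nlinarith
    have : (2 * t) ^ (-(7 / 4) : ℝ) ≤ bracket t ^ (-(7 / 4) : ℝ) :=
      Real.rpow_le_rpow_of_nonpos (by linarith) hbt (by norm_num)
    rw [Real.mul_rpow (by norm_num) ht] at this
    rw [hτt]
    have ht' : 0 ≤ t ^ (-(7 / 4) : ℝ) := by positivity
    nlinarith
  · refine (hreg M τ v (alphaOp μ) k hvm hM h50).mono ?_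
    rw [← mul_one (c₁ * _)]
    refine fin _ _ hc₁.le (by linarith) zero_le_one ?_
    have hbt : bracket t ≤ 2 := by nlinarith
    have : (2 : ℝ) ^ (-(7 / 4) : ℝ) ≤ bracket t ^ (-(7 / 4) : ℝ) :=
      Real.rpow_le_rpow_of_nonpos (by linarith) hbt (by norm_num)
    linarith

end DiracCSP

end

theorem mainTheorem5 (ρ : DiracCSP.Plane → ℝ) (hρ : DiracCSP.IsLittlewoodPaley ρ)
    (s : ℝ) (hs : 50 ≤ s) (K : ℝ) (hK : 0 < K) (γ : ℝ) (hγ : 0 < γ) :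
    ∃ C : ℝ, 0 < C ∧
      ∀ (T ε₁ : ℝ) (ψ : ℝ → DiracCSP.L2Spinor), 0 < ε₁ →
        DiracCSP.sigmaNorm s T ψ ≤ ENNReal.ofReal (K * ε₁) →
        ∀ (θ : ℤˣ) (μ : Fin 3) (k : ℤ), ∀ t ∈ Set.Icc (0 : ℝ) T,
          eLpNorm (DiracCSP.lpProj ρ ((2 : ℝ) ^ k)
              (DiracCSP.density μ (DiracCSP.proj θ (ψ t)))) 2 volume ≤
            ENNReal.ofReal (C * ((2 : ℝ) ^ k)⁻¹ *
              DiracCSP.bracket t ^ (-(7 / 4 : ℝ) + γ) * ε₁ ^ 2) := by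
  obtain ⟨C₁, hC₁, hlp⟩ := DiracCSP.exists_eLpNorm_lpProj_le hρ
  obtain ⟨C₂, hC₂, hden⟩ := DiracCSP.exists_l2Bound_derivSym_density γ hγ.le
  refine ⟨C₁ * C₂ * K ^ 2, by positivity, fun T ε₁ ψ hε hσ θ μ k t ht => ?_⟩
  have h := (DiracCSP.sobolevNorm_add_le_sigmaNorm s T ψ θ ht).trans hσ
  obtain ⟨hi, hb⟩ := hden s hs (K * ε₁) (by positivity) θ t ht.1 _ (le_self_add.trans h)
    (le_add_self.trans h) μ
  have hB : 0 ≤ DiracCSP.bracket t := Real.sqrt_nonneg _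
  refine (hlp _ _ _ (by positivity) hi (by positivity) hb).trans (ENNReal.ofReal_le_ofReal ?_)
  refine le_of_eq ?_
  ring
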